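/- Let $M$ be a smooth $n$-dimensional manifold and let $E=\mathbb R\times TM$, with adapted coordinates $(t,x^i,u^i)$. Let $\Gamma$ be a smooth second-order differential equation field on $E$, locally $\Gamma=\frac{\partial}{\partial t}+u^i\frac{\partial}{\partial x^i}+F^j\frac{\partial}{\partial u^j}$. Put $$V_i=\frac{\partial}{\partial u^i},\qquad \theta^i=dx^i-u^i\,dt,\qquad \Gamma^i_j=-\tfrac12\frac{\partial F^i}{\partial u^j},\qquad H_i=\frac{\partial}{\partial x^i}-\Gamma^j_i\frac{\partial}{\partial u^j},$$ and let $S=\theta^i\otimes V_i$ be the vertical endomorphism, $(\mathcal L_\Gamma S)(Y)=[\Gamma,S(Y)]-S([\Gamma,Y])$. (0) Each tangent space of $E$ is the direct sum of the eigenspaces of the $(1,1)$ tensor $\mathcal L_\Gamma S$ for the eigenvalues $0,1,-1$. These are respectively $\mathrm{Sp}\{\Gamma\}$, the vertical space $V(E)$ (the kernel of the differential of $E\to\mathbb R\times M$) and the horizontal space $H(E)=\mathrm{Sp}\{H_i\}$. Let $P_\Gamma,P_V,P_H$ be the corresponding projectors. There is a unique $(1,1)$ tensor $Q$ on $E$ with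 values in $H(E)$ such that $Q\circ S=P_H$ and $S\circ Q=P_V$, and $Q$ is smooth. (1) The distributions $\mathrm{Im}(P_\Gamma)$, $\mathrm{Im}(P_H)$, $\mathrm{Im}(P_V)$ carry the covariant derivatives $$\nabla^\Gamma_XY=X(dt(Y))\,\Gamma,\qquad \nabla^H_XY=Q([X,S(Y)]),\qquad \nabla^V_XY=S([X,Q(Y)])$$ respectively: for smooth sections $X,Y$ of the distribution over an open subset of $E$, the result is smooth, additive in $X$ and in $Y$, and satisfies $\nabla_{fX}Y=f\nabla_XY$ and $\nabla_X(fY)=X(f)Y+f\nabla_XY$ for smooth functions $f$. Each of them takes values in the distribution concerned. (2) For a projector $P$ and a covariant derivative $\nabla^P$ on $\mathrm{Im}(P)$, put $\bar\nabla^P_XY=\nabla^P_{P(X)}Y+P([X-P(X),Y])$ for arbitrary $X$ and for $Y\in\mathrm{Im}(P)$. Then $$\hat\nabla_XY:=\bar\nabla^\Gamma_X(P_\Gamma(Y))+\bar\nabla^H_X(P_H(Y))+\bar\nabla^V_X(P_V(Y))$$ is a linear connection on $E$, and in every adapted chart its components in the frame $\{\Gamma,H_i,V_i\}$ are $$\hat\nabla_\Gamma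 H_i=\Gamma^j_iH_j,\quad \hat\nabla_\Gamma V_i=\Gamma^j_iV_j,\quad \hat\nabla_{H_i}H_j=\frac{\partial\Gamma^k_i}{\partial u^j}H_k,\quad \hat\nabla_{H_i}V_j=\frac{\partial\Gamma^k_i}{\partial u^j}V_k,$$ all the others being zero. These are the components of the Massa–Pagani connection, and a linear connection on $E$ with these components in all adapted charts equals $\hat\nabla$; thus $\hat\nabla$ is the Massa–Pagani connection. (3) Explicitly, for smooth vector fields $X,Y$ on $E$ (or on an open subset of $E$), $$\hat\nabla_XY=X(dt(Y))\,\Gamma+Q([P_H(X),S(Y)])+S([P_V(X),Q(Y)])+P_H([X-P_H(X),P_H(Y)])+P_V([X-P_V(X),P_V(Y)]).$$ -/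

import Mathlib

open scoped Manifold ContDiff Topology

noncomputable section

namespace SODEGeometry

/-! ### Vector fields on a manifold -/

section General

variable {A : Type*} [NormedAddCommGroup A] [NormedSpace ℝ A] {H : Type*} [TopologicalSpace H]
  (I : ModelWithCorners ℝ A H) {N : Type*} [TopologicalSpace N] [ChartedSpace H N]

/-- Vector fields, without any regularity. -/
abbrev VField (I : ModelWithCorners ℝ A H) (N : Type*) [TopologicalSpace N] [ChartedSpace H N] :=
  (p : N) → TangentSpace I p

/-- Fields of endomorphisms of the tangent spaces, without any regularity. -/
abbrev EndField (I : ModelWithCorners ℝ A H) (N : Type*) [TopologicalSpace N] [ChartedSpace H N] :=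
  (p : N) → (TangentSpace I p →ₗ[ℝ] TangentSpace I p)

/-- A field of endomorphisms applied pointwise to a vector field. -/
def EndField.on {I : ModelWithCorners ℝ A H} {N : Type*} [TopologicalSpace N] [ChartedSpace H N]
    (P : EndField I N) (Y : VField I N) : VField I N := fun p => P p (Y p)

/-- The derivative `X(f)` of a function along a vector field. -/
def dirDeriv (X : VField I N) (f : N → ℝ) : N → ℝ := fun p => mfderiv I 𝓘(ℝ, ℝ) f p (X p)

/-- The Lie bracket `[X, Y]`. -/
abbrev bracket (X Y : VField I N) : VField I N := VectorField.mlieBracket I X Y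

/-- The vector field `Y` is `C^∞` on the set `U`. -/
def SmoothOn [IsManifold I 1 N] (U : Set N) (Y : VField I N) : Prop :=
  ContMDiffOn I I.tangent ∞ (fun p => (⟨p, Y p⟩ : TangentBundle I N)) U

/-- The vector field `Y` is `C^∞` near the point `p`. -/
def SmoothAt [IsManifold I 1 N] (p : N) (Y : VField I N) : Prop :=
  ContMDiffAt I I.tangent ∞ (fun q => (⟨q, Y q⟩ : TangentBundle I N)) p

/-- `P` is a smooth `(1,1)` tensor field: it maps smooth vector fields to smooth ones. -/
def IsSmoothTensor [IsManifold I 1 N] (P : EndField I N) : Prop :=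
  ∀ (U : Set N), IsOpen U → ∀ Y : VField I N, SmoothOn I U Y → SmoothOn I U (P.on Y)

/-- `D` is a covariant derivative on the distribution `Δ`: for smooth sections `X`, `Y` of `Δ` over
an arbitrary open set `U` (for instance the whole manifold) `D X Y` is a smooth vector field on `U`,
additive in both arguments, linear over functions in `X` and a derivation in `Y`.
(Homogeneity over `ℝ` is the case of constant functions.)  It is not required that `D X Y` takes
values in `Δ`. -/
structure IsCovDerivOn [IsManifold I 1 N] (Δ : (p : N) → Submodule ℝ (TangentSpace I p))
    (D : VField I N → VField I N → VField I N) : Prop where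
  smooth : ∀ U : Set N, IsOpen U → ∀ X Y : VField I N, SmoothOn I U X → SmoothOn I U Y →
    (∀ p ∈ U, X p ∈ Δ p) → (∀ p ∈ U, Y p ∈ Δ p) → SmoothOn I U (D X Y)
  add_left : ∀ U : Set N, IsOpen U → ∀ X X' Y : VField I N,
    SmoothOn I U X → SmoothOn I U X' → SmoothOn I U Y →
    (∀ p ∈ U, X p ∈ Δ p) → (∀ p ∈ U, X' p ∈ Δ p) → (∀ p ∈ U, Y p ∈ Δ p) →
    ∀ p ∈ U, D (fun q => X q + X' q) Y p = D X Y p + D X' Y p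
  add_right : ∀ U : Set N, IsOpen U → ∀ X Y Y' : VField I N,
    SmoothOn I U X → SmoothOn I U Y → SmoothOn I U Y' →
    (∀ p ∈ U, X p ∈ Δ p) → (∀ p ∈ U, Y p ∈ Δ p) → (∀ p ∈ U, Y' p ∈ Δ p) →
    ∀ p ∈ U, D X (fun q => Y q + Y' q) p = D X Y p + D X Y' p
  smul_left : ∀ U : Set N, IsOpen U → ∀ (f : N → ℝ) (X Y : VField I N),
    ContMDiffOn I 𝓘(ℝ, ℝ) ∞ f U → SmoothOn I U X → SmoothOn I U Y →
    (∀ p ∈ U, X p ∈ Δ p) → (∀ p ∈ U, Y p ∈ Δ p) →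
    ∀ p ∈ U, D (fun q => f q • X q) Y p = f p • D X Y p
  leibniz : ∀ U : Set N, IsOpen U → ∀ (f : N → ℝ) (X Y : VField I N),
    ContMDiffOn I 𝓘(ℝ, ℝ) ∞ f U → SmoothOn I U X → SmoothOn I U Y →
    (∀ p ∈ U, X p ∈ Δ p) → (∀ p ∈ U, Y p ∈ Δ p) →
    ∀ p ∈ U, D X (fun q => f q • Y q) p = dirDeriv I X f p • Y p + f p • D X Y p

/-- Linear connections: covariant derivatives on the whole tangent bundle. -/
def IsLinearConnection [IsManifold I 1 N] (D : VField I N → VField I N → VField I N) : Prop :=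
  IsCovDerivOn I (fun _ => ⊤) D

/-- The operator `D` takes values in the distribution `Δ` on smooth sections of `Δ`. -/
def Preserves [IsManifold I 1 N] (Δ : (p : N) → Submodule ℝ (TangentSpace I p))
    (D : VField I N → VField I N → VField I N) : Prop :=
  ∀ U : Set N, IsOpen U → ∀ X Y : VField I N, SmoothOn I U X → SmoothOn I U Y →
    (∀ p ∈ U, X p ∈ Δ p) → (∀ p ∈ U, Y p ∈ Δ p) → ∀ p ∈ U, D X Y p ∈ Δ p

/-- The extension `D_{P(X)} Y + P([X - P(X), Y])` to arbitrary `X` of a covariant derivative `D` on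
the image of the projector `P`. -/
def extendCov {I : ModelWithCorners ℝ A H} {N : Type*} [TopologicalSpace N] [ChartedSpace H N]
    (P : EndField I N) (D : VField I N → VField I N → VField I N)
    (X Y : VField I N) : VField I N :=
  fun p => D (P.on X) Y p + P p (bracket I (fun q => X q - P.on X q) Y p)

/-- The glued operator `∑ a, D̄ᵃ_X (P_a(Y))`, where `D̄ᵃ` is the extension of `Dᵃ`. -/
def glueCov {I : ModelWithCorners ℝ A H} {N : Type*} [TopologicalSpace N] [ChartedSpace H N]
    {ι : Type*} [Fintype ι] (P : ι → EndField I N)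
    (D : ι → VField I N → VField I N → VField I N) (X Y : VField I N) : VField I N :=
  fun p => ∑ a, extendCov (P a) (D a) X ((P a).on Y) p

/-- `L` is the Lie derivative of the `(1,1)` tensor field `T` along `Γ` at the point `p`, i.e.
`L (Y_p) = [Γ, T(Y)]_p - T([Γ, Y])_p` for all vector fields `Y` smooth near `p`. -/
def IsLieDerivAt [IsManifold I 1 N] (Γ : VField I N) (T : EndField I N) (p : N)
    (L : TangentSpace I p →ₗ[ℝ] TangentSpace I p) : Prop :=
  ∀ Y : VField I N, SmoothAt I p Y →
    L (Y p) = bracket I Γ (T.on Y) p - T p (bracket I Γ Y p)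

/-- The Lie derivative `𝓛_Γ T` of a `(1,1)` tensor field: at each point the linear map
determined by `IsLieDerivAt`. -/
def lieDeriv [IsManifold I 1 N] (Γ : VField I N) (T : EndField I N) : EndField I N :=
  fun p => Classical.epsilon (IsLieDerivAt I Γ T p)

/-- The projector of a vector space `W` onto the eigenspace of `L` for `μ`, along the sum of all the
other eigenspaces (when `W` is the direct sum of the two; otherwise zero, by convention). -/
def eigenProj {W : Type*} [AddCommGroup W] [Module ℝ W] (L : W →ₗ[ℝ] W) (μ : ℝ) : W →ₗ[ℝ] W :=
  open Classical in
  if h : IsCompl (Module.End.eigenspace L μ) (⨆ ν : {ν : ℝ // ν ≠ μ}, Module.End.eigenspace L ν)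
  then Submodule.projection _ _ h else 0

end General

/-! ### The evolution space -/

/-- The model space of `n`-dimensional manifolds. -/
abbrev Rn (n : ℕ) := EuclideanSpace ℝ (Fin n)

variable {n : ℕ} {M : Type*} [TopologicalSpace M] [ChartedSpace (Rn n) M]

/-- The evolution space `E = ℝ × TM`; a point is `p = (t, x, u)` with `p.1 = t`, `p.2.proj = x` and
`p.2.2 = u ∈ T_x M`. -/
abbrev Evo (n : ℕ) (M : Type*) [TopologicalSpace M] [ChartedSpace (Rn n) M] :=
  ℝ × TangentBundle (𝓡 n) M

variable [IsManifold (𝓡 n) ∞ M]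

/-- The model with corners of the manifold `E = ℝ × TM`. -/
abbrev IE (n : ℕ) := 𝓘(ℝ, ℝ).prod (𝓡 n).tangent

/-- The differential of the time coordinate `t : E → ℝ`. -/
def dt (p : Evo n M) : TangentSpace (IE n) p →L[ℝ] ℝ :=
  mfderiv (IE n) 𝓘(ℝ, ℝ) (fun q : Evo n M => q.1) p

/-- The differential of the projection `E → M`, `(t, x, u) ↦ x`. -/
def dx (p : Evo n M) : TangentSpace (IE n) p →L[ℝ] TangentSpace (𝓡 n) p.2.proj :=
  mfderiv (IE n) (𝓡 n) (fun q : Evo n M => q.2.proj) p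

/-- The contact form with values in `T_x M`: `ξ ↦ dx(ξ) - dt(ξ) u`, i.e. `dxⁱ - uⁱ dt`. -/
def contact (p : Evo n M) : TangentSpace (IE n) p →L[ℝ] TangentSpace (𝓡 n) p.2.proj :=
  dx p - (dt p).smulRight p.2.2

/-- The vertical lift `T_x M → T_p E` at `p = (t, x, u)`: the derivative at `u` of the inclusion
`w ↦ (t, x, w)` of the fibre `T_x M`. -/
def vlift (p : Evo n M) : TangentSpace (𝓡 n) p.2.proj →L[ℝ] TangentSpace (IE n) p :=
  mfderiv 𝓘(ℝ, Rn n) (IE n) (fun w : Rn n => ((p.1, ⟨p.2.proj, w⟩) : Evo n M)) p.2.2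

/-- The vertical endomorphism `S = θⁱ ⊗ ∂/∂uⁱ`: the vertical lift of the contact form. -/
def vertEndo (n : ℕ) (M : Type*) [TopologicalSpace M] [ChartedSpace (Rn n) M]
    [IsManifold (𝓡 n) ∞ M] : EndField (IE n) (Evo n M) :=
  fun p => ((vlift p).comp (contact p)).toLinearMap

/-- The vertical space `V_p(E)`: the kernel at `p` of the differential of the projection
`E → ℝ × M`. -/
def vertSpace (p : Evo n M) : Submodule ℝ (TangentSpace (IE n) p) :=
  LinearMap.ker (mfderiv (IE n) (𝓘(ℝ, ℝ).prod (𝓡 n))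
    (fun q : Evo n M => ((q.1, q.2.proj) : ℝ × M)) p).toLinearMap

/-- Second-order differential equation fields: smooth vector fields `Γ` on `E` with `dt(Γ) = 1` and
`dx(Γ) = u`, i.e. `Γ = ∂/∂t + uⁱ ∂/∂xⁱ + Fʲ ∂/∂uʲ` in adapted coordinates. -/
structure IsSODE (Γ : VField (IE n) (Evo n M)) : Prop where
  smooth : SmoothOn (IE n) Set.univ Γ
  dt_eq : ∀ p, dt p (Γ p) = 1
  dx_eq : ∀ p, dx p (Γ p) = p.2.2

variable (Γ : VField (IE n) (Evo n M))

/-! ### The splitting given by `𝓛_Γ S` -/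

/-- The deformation `𝓛_Γ S`. -/
def LS : EndField (IE n) (Evo n M) := lieDeriv (IE n) Γ (vertEndo n M)

/-- The eigendistribution of `𝓛_Γ S` for the eigenvalue `μ`. -/
def eigenDist (μ : ℝ) (p : Evo n M) : Submodule ℝ (TangentSpace (IE n) p) :=
  Module.End.eigenspace (LS Γ p) μ

/-- The projector `P_Γ` onto the eigendistribution for `0`. -/
def PΓ : EndField (IE n) (Evo n M) := fun p => eigenProj (LS Γ p) 0

/-- The projector `P_V` onto the eigendistribution for `1`. -/
def PV : EndField (IE n) (Evo n M) := fun p => eigenProj (LS Γ p) 1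

/-- The projector `P_H` onto the eigendistribution for `-1`. -/
def PH : EndField (IE n) (Evo n M) := fun p => eigenProj (LS Γ p) (-1)

/-- The characterization of `Q`: it takes values in `H(E)`, and `Q ∘ S = P_H`, `S ∘ Q = P_V`. -/
def IsQAt (p : Evo n M) (q : TangentSpace (IE n) p →ₗ[ℝ] TangentSpace (IE n) p) : Prop :=
  (∀ v, q v ∈ eigenDist Γ (-1) p) ∧
  (∀ v, q (vertEndo n M p v) = PH Γ p v) ∧
  (∀ v, vertEndo n M p (q v) = PV Γ p v)

/-- The `(1,1)` tensor field `Q` determined by `IsQAt`. -/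
def Q : EndField (IE n) (Evo n M) := fun p => Classical.epsilon (IsQAt Γ p)

/-! ### The submodule derivatives and the glued connection -/

/-- `∇^Γ_X Y = X(dt(Y)) Γ`. -/
def covΓ (X Y : VField (IE n) (Evo n M)) : VField (IE n) (Evo n M) :=
  fun p => dirDeriv (IE n) X (fun q => dt q (Y q)) p • Γ p

/-- `∇^H_X Y = Q([X, S(Y)])`. -/
def covH (X Y : VField (IE n) (Evo n M)) : VField (IE n) (Evo n M) :=
  fun p => Q Γ p (bracket (IE n) X ((vertEndo n M).on Y) p)

/-- `∇^V_X Y = S([X, Q(Y)])`. -/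
def covV (X Y : VField (IE n) (Evo n M)) : VField (IE n) (Evo n M) :=
  fun p => vertEndo n M p (bracket (IE n) X ((Q Γ).on Y) p)

/-- The operator obtained by gluing `∇^Γ`, `∇^H` and `∇^V`. -/
def nablaHat (X Y : VField (IE n) (Evo n M)) : VField (IE n) (Evo n M) :=
  glueCov ![PΓ Γ, PH Γ, PV Γ] ![covΓ Γ, covH Γ, covV Γ] X Y

/-! ### Adapted coordinates and frames -/

/-- The domain in `E` of the adapted coordinates induced by a chart `e` of `M`. -/
def adaptedDomain (e : OpenPartialHomeomorph M (Rn n)) : Set (Evo n M) :=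
  {p | p.2.proj ∈ e.source}

/-- The adapted coordinates `(t, x, u) ↦ (t, (xⁱ), (uⁱ))` on `E` induced by a chart `e` of `M`. -/
def coords (e : OpenPartialHomeomorph M (Rn n)) (p : Evo n M) : ℝ × Rn n × Rn n :=
  (p.1, e p.2.proj, mfderiv (𝓡 n) (𝓡 n) e p.2.proj p.2.2)

/-- The differential of the adapted coordinates. -/
def dcoords (e : OpenPartialHomeomorph M (Rn n)) (p : Evo n M) :
    TangentSpace (IE n) p →L[ℝ] (ℝ × Rn n × Rn n) :=
  mfderiv (IE n) 𝓘(ℝ, ℝ × Rn n × Rn n) (coords e) p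

/-- The coordinate field `∂/∂xⁱ` on the domain of the adapted coordinates. -/
def partialX (e : OpenPartialHomeomorph M (Rn n)) (i : Fin n) : VField (IE n) (Evo n M) :=
  fun p => (dcoords e p).inverse (0, EuclideanSpace.single i 1, 0)

/-- The coordinate field `V_i = ∂/∂uⁱ` on the domain of the adapted coordinates. -/
def vertFrame (e : OpenPartialHomeomorph M (Rn n)) (i : Fin n) : VField (IE n) (Evo n M) :=
  fun p => (dcoords e p).inverse (0, 0, EuclideanSpace.single i 1)

/-- The functions `Fⁱ = Γ(uⁱ)`, the right-hand sides of the equations. -/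
def force (e : OpenPartialHomeomorph M (Rn n)) (i : Fin n) : Evo n M → ℝ :=
  fun p => (dcoords e p (Γ p)).2.2 i

/-- The components `Γⁱ_j = -½ ∂Fⁱ/∂uʲ` of the nonlinear connection. -/
def nlc (e : OpenPartialHomeomorph M (Rn n)) (i j : Fin n) : Evo n M → ℝ :=
  fun p => -(1 / 2 : ℝ) * dirDeriv (IE n) (vertFrame e j) (force Γ e i) p

/-- The horizontal fields `H_i = ∂/∂xⁱ - Γʲ_i ∂/∂uʲ`. -/
def horFrame (e : OpenPartialHomeomorph M (Rn n)) (i : Fin n) : VField (IE n) (Evo n M) :=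
  fun p => partialX e i p - ∑ j, nlc Γ e j i p • vertFrame e j p

/-- The derivatives `∂Γᵏ_i/∂uʲ`. -/
def dnlc (e : OpenPartialHomeomorph M (Rn n)) (k i j : Fin n) : Evo n M → ℝ :=
  dirDeriv (IE n) (vertFrame e j) (nlc Γ e k i)

/-- The Massa–Pagani connection of `Γ`, as known from its components in the adapted frames
`{Γ, H_i, V_i}`: a linear connection `D` on `E` whose only nonzero components, for every chart of
`M`, are `D_Γ H_i = Γʲ_i H_j`, `D_Γ V_i = Γʲ_i V_j`, `D_{H_i} H_j = (∂Γᵏ_i/∂uʲ) H_k` and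
`D_{H_i} V_j = (∂Γᵏ_i/∂uʲ) V_k`. -/
structure IsMassaPagani
    (D : VField (IE n) (Evo n M) → VField (IE n) (Evo n M) → VField (IE n) (Evo n M)) : Prop where
  linear : IsLinearConnection (IE n) D
  components : ∀ e ∈ IsManifold.maximalAtlas (𝓡 n) ∞ M, ∀ p ∈ adaptedDomain e,
    D Γ Γ p = 0 ∧ ∀ i j : Fin n,
    D (horFrame Γ e i) Γ p = 0 ∧ D (vertFrame e i) Γ p = 0 ∧
    D Γ (horFrame Γ e i) p = ∑ k, nlc Γ e k i p • horFrame Γ e k p ∧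
    D Γ (vertFrame e i) p = ∑ k, nlc Γ e k i p • vertFrame e k p ∧
    D (horFrame Γ e i) (horFrame Γ e j) p = ∑ k, dnlc Γ e k i j p • horFrame Γ e k p ∧
    D (horFrame Γ e i) (vertFrame e j) p = ∑ k, dnlc Γ e k i j p • vertFrame e k p ∧
    D (vertFrame e i) (horFrame Γ e j) p = 0 ∧ D (vertFrame e i) (vertFrame e j) p = 0

end SODEGeometry

end

open SODEGeometry

open scoped Manifold ContDiff Topology

noncomputable section

namespace SODEGeometry

/-! ### Derivatives of functions and Lie brackets on a manifold -/

section General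

variable {A : Type*} [NormedAddCommGroup A] [NormedSpace ℝ A] {H : Type*} [TopologicalSpace H]
  {I : ModelWithCorners ℝ A H} {N : Type*} [TopologicalSpace N] [ChartedSpace H N]
  {F : Type*} [NormedAddCommGroup F] [NormedSpace ℝ F]
  {F' : Type*} [NormedAddCommGroup F'] [NormedSpace ℝ F']

/-! Write a tangent vector in adapted coordinates as `y = (y⁰, y¹, y²)`, and put `θ = y¹ - y⁰u` and
`A = ∂F/∂u`, so that `Γ = (1, u, F)` and `S y = (0, 0, θ)`. Expanding the brackets in `[Γ, S(Y)] -
S([Γ, Y])`, every derivative of a component of `Y` cancels, and what is left is the pointwise linear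
map `L y = (0, -θ, y² - y⁰F - Aθ)` (`deformCoord_dcoords`). It satisfies `L³ = L`, so the
eigenprojectors are `1 - L²`, `(L² + L)/2` and `(L² - L)/2`. With `ρ = y² - y⁰F - ½Aθ` this gives
`P_Γ y = y⁰Γ`, `P_H y = (0, θ, ½Aθ)`, `P_V y = (0, 0, ρ)` and `Q y = (0, ρ, ½Aρ)`, from which all
the algebra of part (0) can be read off.

In the glued operator the `Γ` summand collapses to `X(dt(Y)) Γ` because `dt` is closed, and `S ∘ P_H
= S`, `Q ∘ P_V = Q` turn the rest into four terms of the form `T₁([P(X), T₂(Y)])`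
(`nablaHat_eq_nablaSum`). Such a term is function-linear in `X` as soon as `T₁ ∘ P = 0`, and this
holds because `Q ∘ P_H`, `S ∘ P_V` and `P ∘ (1 - P)` all vanish. In `Y` it contributes `(P(X))(f)
T₁(T₂(Y))` to the Leibniz rule. The contributions along `P_H(X)` and `X - P_H(X)`, and likewise for
`V`, add up to `X(f)`, so the sum is a linear connection.

The components come from brackets of frame fields: `[H_i, V_j] = (∂Γᵏ_i/∂uʲ) V_k`, and the needed
projections of `[Γ, H_i]` and `[Γ, V_i]`. Uniqueness holds because a linear connection is local and
hence determined by its values on a local frame (`IsLinearConnection.eq_of_frame`). -/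

/-- The derivative `X(f)` of a vector-valued function along a vector field. -/
def vecDeriv (I : ModelWithCorners ℝ A H) (X : VField I N) (f : N → F) : N → F :=
  fun p => mvfderiv I f p (X p)

lemma dirDeriv_eq_vecDeriv (X : VField I N) (f : N → ℝ) : dirDeriv I X f = vecDeriv I X f := rfl

lemma dirDeriv_sub_left {X Y Z : VField I N} {p : N} (h : Z p = X p - Y p) (f : N → ℝ) :
    dirDeriv I Z f p = dirDeriv I X f p - dirDeriv I Y f p := by
  simp only [dirDeriv, h, map_sub]
  rfl

lemma vecDeriv_congr {X Y : VField I N} {f g : N → F} {p : N} (h : X p = Y p)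
    (hfg : f =ᶠ[𝓝 p] g) : vecDeriv I X f p = vecDeriv I Y g p := by
  have : mfderiv I 𝓘(ℝ, F) f p (X p) = mfderiv I 𝓘(ℝ, F) g p (Y p) := by
    rw [h, hfg.mfderiv_eq]
    rfl
  exact this

lemma vecDeriv_const (X : VField I N) (c : F) (p : N) : vecDeriv I X (fun _ => c) p = 0 := by
  simp [vecDeriv, mvfderiv_const]

lemma vecDeriv_add_left {X Y Z : VField I N} {p : N} (h : Z p = X p + Y p) (f : N → F) :
    vecDeriv I Z f p = vecDeriv I X f p + vecDeriv I Y f p := by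
  simp [vecDeriv, h]

lemma vecDeriv_add (X : VField I N) {f g : N → F} {p : N}
    (hf : MDifferentiableAt I 𝓘(ℝ, F) f p) (hg : MDifferentiableAt I 𝓘(ℝ, F) g p) :
    vecDeriv I X (fun q => f q + g q) p = vecDeriv I X f p + vecDeriv I X g p := by
  have := mvfderiv_add hf hg
  exact congrArg (fun L => L (X p)) this

lemma vecDeriv_sub (X : VField I N) {f g : N → F} {p : N}
    (hf : MDifferentiableAt I 𝓘(ℝ, F) f p) (hg : MDifferentiableAt I 𝓘(ℝ, F) g p) :
    vecDeriv I X (fun q => f q - g q) p = vecDeriv I X f p - vecDeriv I X g p := by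
  have := mvfderiv_sub hf hg
  exact congrArg (fun L => L (X p)) this

lemma vecDeriv_smul (X : VField I N) {a : N → ℝ} {g : N → F} {p : N}
    (ha : MDifferentiableAt I 𝓘(ℝ, ℝ) a p) (hg : MDifferentiableAt I 𝓘(ℝ, F) g p) :
    vecDeriv I X (fun q => a q • g q) p = a p • vecDeriv I X g p + vecDeriv I X a p • g p := by
  have := mvfderiv_smul ha hg
  exact congrArg (fun L => L (X p)) this

lemma vecDeriv_clm (X : VField I N) (L : F →L[ℝ] F') {f : N → F} {p : N}
    (hf : MDifferentiableAt I 𝓘(ℝ, F) f p) :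
    vecDeriv I X (fun q => L (f q)) p = L (vecDeriv I X f p) := by
  have h1 : HasMFDerivAt 𝓘(ℝ, F) 𝓘(ℝ, F') L (f p) L := L.hasFDerivAt.hasMFDerivAt
  have := (h1.comp p hf.hasMFDerivAt).mfderiv
  exact congrArg (fun L => L (X p)) this

lemma vecDeriv_fderiv_comp (X : VField I N) {g : F → F'} {f : N → F} {p : N}
    (hg : DifferentiableAt ℝ g (f p)) (hf : MDifferentiableAt I 𝓘(ℝ, F) f p) :
    vecDeriv I X (fun q => g (f q)) p = fderiv ℝ g (f p) (vecDeriv I X f p) := by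
  have h1 : HasMFDerivAt 𝓘(ℝ, F) 𝓘(ℝ, F') g (f p) (fderiv ℝ g (f p)) :=
    hg.hasFDerivAt.hasMFDerivAt
  have := (h1.comp p hf.hasMFDerivAt).mfderiv
  exact congrArg (fun L => L (X p)) this

lemma bracket_congr {X X' Y Y' : VField I N} {p : N} (hX : X =ᶠ[𝓝 p] X') (hY : Y =ᶠ[𝓝 p] Y') :
    bracket I X Y p = bracket I X' Y' p :=
  hX.mlieBracket_vectorField_eq hY

lemma bracket_zero_left {X Y : VField I N} {p : N} (hX : ∀ᶠ q in 𝓝 p, X q = 0) :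
    bracket I X Y p = 0 := by
  rw [bracket_congr (X' := 0) hX (Filter.EventuallyEq.refl _ Y)]
  simp [bracket]

lemma bracket_zero_right {X Y : VField I N} {p : N} (hY : ∀ᶠ q in 𝓝 p, Y q = 0) :
    bracket I X Y p = 0 := by
  rw [bracket_congr (Y' := 0) (Filter.EventuallyEq.refl _ X) hY]
  simp [bracket]

lemma mlieBracket_vectorSpace (V W : (z : F) → TangentSpace 𝓘(ℝ, F) z) (z : F) :
    VectorField.mlieBracket 𝓘(ℝ, F) V W z =
      fderiv ℝ (W : F → F) z (V z) - fderiv ℝ (V : F → F) z (W z) := by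
  rw [← VectorField.mlieBracketWithin_univ, VectorField.mlieBracketWithin_eq_lieBracketWithin]
  exact congrFun (VectorField.lieBracketWithin_univ (𝕜 := ℝ) (V := (V : F → F))
    (W := (W : F → F))) z

variable [IsManifold I 1 N]

lemma SmoothAt.congr {X Y : VField I N} {p : N} (hX : SmoothAt I p X)
    (h : X =ᶠ[𝓝 p] Y) : SmoothAt I p Y := by
  refine ContMDiffAt.congr_of_eventuallyEq hX ?_
  filter_upwards [h] with q hq
  rw [hq]

lemma SmoothOn.smoothAt {U : Set N} (hU : IsOpen U) {X : VField I N}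
    (hX : SmoothOn I U X) {p : N} (hp : p ∈ U) : SmoothAt I p X :=
  ContMDiffOn.contMDiffAt hX (hU.mem_nhds hp)

lemma smoothOn_of_smoothAt {U : Set N} {X : VField I N}
    (h : ∀ p ∈ U, SmoothAt I p X) : SmoothOn I U X :=
  fun p hp => ContMDiffAt.contMDiffWithinAt (h p hp)

lemma SmoothAt.mdiff {X : VField I N} {p : N} (hX : SmoothAt I p X) :
    MDifferentiableAt I I.tangent (fun q => (⟨q, X q⟩ : TangentBundle I N)) p :=
  ContMDiffAt.mdifferentiableAt hX (by simp)

lemma SmoothAt.add {X Y : VField I N} {p : N} (hX : SmoothAt I p X) (hY : SmoothAt I p Y) :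
    SmoothAt I p (fun q => X q + Y q) :=
  ContMDiffAt.add_section hX hY

lemma SmoothAt.sub {X Y : VField I N} {p : N} (hX : SmoothAt I p X) (hY : SmoothAt I p Y) :
    SmoothAt I p (fun q => X q - Y q) :=
  ContMDiffAt.sub_section hX hY

lemma SmoothAt.smul {f : N → ℝ} {X : VField I N} {p : N} (hf : ContMDiffAt I 𝓘(ℝ, ℝ) ∞ f p)
    (hX : SmoothAt I p X) : SmoothAt I p (fun q => f q • X q) :=
  ContMDiffAt.smul_section hf hX

/-- The tangent map of `f` carries the smooth section `X` to a smooth curve of tangent vectors of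
`F`, and the tangent bundle of a vector space is trivial, so its fibre component is smooth. -/
lemma SmoothAt.vecDeriv {X : VField I N} {f : N → F} {p : N} (hX : SmoothAt I p X)
    (hf : ContMDiffAt I 𝓘(ℝ, F) ∞ f p) :
    ContMDiffAt I 𝓘(ℝ, F) ∞ (vecDeriv I X f) p := by
  have h1 := hf.mfderiv_const (m := ∞) (by simp)
  have h2 : ContMDiffAt I 𝓘(ℝ, F).tangent ∞
      (fun q => (⟨f q, mfderiv I 𝓘(ℝ, F) f q (X q)⟩ : TangentBundle 𝓘(ℝ, F) F)) p :=
    ContMDiffAt.clm_apply_of_inCoordinates h1 hX hf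
  exact (contMDiff_snd_tangentBundle_modelSpace F 𝓘(ℝ, F)).contMDiffAt.comp p h2

variable [IsManifold I ∞ N] [CompleteSpace A]

omit [IsManifold I 1 N] [CompleteSpace A] in
lemma isManifold_two_of_smooth : IsManifold I 2 N := inferInstance

lemma SmoothAt.bracket {X Y : VField I N} {p : N} (hX : SmoothAt I p X) (hY : SmoothAt I p Y) :
    SmoothAt I p (bracket I X Y) := by
  have : IsManifold I (minSmoothness ℝ 2) N := by
    simpa using isManifold_two_of_smooth (I := I) (N := N)
  have : IsManifold I (((⊤ : ℕ∞) : ℕ∞ω) + 1) N := by simpa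
  exact ContMDiffAt.mlieBracket_vectorField (m := ⊤) (n := ⊤) hX hY (by simp)

lemma bracket_add_left {X X' Y : VField I N} {p : N} (hX : SmoothAt I p X)
    (hX' : SmoothAt I p X') :
    bracket I (fun q => X q + X' q) Y p = bracket I X Y p + bracket I X' Y p := by
  have := isManifold_two_of_smooth (I := I) (N := N)
  exact VectorField.mlieBracket_add_left hX.mdiff hX'.mdiff

lemma bracket_add_right {X Y Y' : VField I N} {p : N} (hY : SmoothAt I p Y)
    (hY' : SmoothAt I p Y') :
    bracket I X (fun q => Y q + Y' q) p = bracket I X Y p + bracket I X Y' p := by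
  have := isManifold_two_of_smooth (I := I) (N := N)
  exact VectorField.mlieBracket_add_right hY.mdiff hY'.mdiff

lemma bracket_smul_left {f : N → ℝ} {X Y : VField I N} {p : N}
    (hf : ContMDiffAt I 𝓘(ℝ, ℝ) ∞ f p) (hX : SmoothAt I p X) :
    bracket I (fun q => f q • X q) Y p = -dirDeriv I Y f p • X p + f p • bracket I X Y p := by
  have := isManifold_two_of_smooth (I := I) (N := N)
  have := VectorField.mlieBracket_smul_left (W := Y) (hf.mdifferentiableAt (by simp)) hX.mdiff
  exact this

lemma bracket_smul_right {f : N → ℝ} {X Y : VField I N} {p : N}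
    (hf : ContMDiffAt I 𝓘(ℝ, ℝ) ∞ f p) (hY : SmoothAt I p Y) :
    bracket I X (fun q => f q • Y q) p = dirDeriv I X f p • Y p + f p • bracket I X Y p := by
  have := isManifold_two_of_smooth (I := I) (N := N)
  have := VectorField.mlieBracket_smul_right (V := X) (hf.mdifferentiableAt (by simp)) hY.mdiff
  exact this

/-! ### Vector fields and brackets in a smooth coordinate system -/

/-- `φ` is a smooth coordinate system on the open set `U`, with smooth local inverse `ψ`. -/
structure IsCoordSystem (I : ModelWithCorners ℝ A H) (φ : N → F) (ψ : F → N) (U : Set N) :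
    Prop where
  isOpen : IsOpen U
  smooth : ∀ p ∈ U, ContMDiffAt I 𝓘(ℝ, F) ∞ φ p
  smooth_symm : ∀ p ∈ U, ContMDiffAt 𝓘(ℝ, F) I ∞ ψ (φ p)
  left_inv : ∀ p ∈ U, ψ (φ p) = p
  right_inv : ∀ p ∈ U, ∀ᶠ z in 𝓝 (φ p), φ (ψ z) = z

/-- The vector field with components `g` in the coordinate system `φ`. -/
def fieldOf (I : ModelWithCorners ℝ A H) (φ : N → F) (g : N → F) : VField I N :=
  fun p => (mvfderiv I φ p).inverse (g p)

namespace IsCoordSystem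

variable {φ : N → F} {ψ : F → N} {U : Set N}

omit [IsManifold I ∞ N] [IsManifold I 1 N] [CompleteSpace A] in
lemma isInvertible (h : IsCoordSystem I φ ψ U) {p : N} (hp : p ∈ U) :
    (mfderiv I 𝓘(ℝ, F) φ p).IsInvertible := by
  have hφ := (h.smooth p hp).mdifferentiableAt (by simp)
  have hψ := (h.smooth_symm p hp).mdifferentiableAt (by simp)
  -- The chain rule for `φ ∘ ψ` needs the derivative of `φ` at `ψ (φ p)`, which equals `p` only
  -- propositionally, while tangent spaces depend on the point.
  have hφ' : ∀ q, q = p → HasMFDerivAt I 𝓘(ℝ, F) φ q (mfderiv I 𝓘(ℝ, F) φ p) := by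
    rintro q rfl
    exact hφ.hasMFDerivAt
  refine ContinuousLinearMap.IsInvertible.of_inverse
    (g := (mfderiv 𝓘(ℝ, F) I ψ (φ p))) ?_ ?_
  · have h1 := (hφ' _ (h.left_inv p hp)).comp (φ p) hψ.hasMFDerivAt
    have h2 : HasMFDerivAt 𝓘(ℝ, F) 𝓘(ℝ, F) (φ ∘ ψ) (φ p)
        (ContinuousLinearMap.id ℝ (TangentSpace 𝓘(ℝ, F) (φ p))) :=
      (hasMFDerivAt_id (φ p)).congr_of_eventuallyEq (h.right_inv p hp)
    exact hasMFDerivAt_unique h1 h2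
  · have h1 := hψ.hasMFDerivAt.comp p hφ.hasMFDerivAt
    have h2 : HasMFDerivAt I I (ψ ∘ φ) p (ContinuousLinearMap.id ℝ (TangentSpace I p)) := by
      refine (hasMFDerivAt_id p).congr_of_eventuallyEq ?_
      filter_upwards [h.isOpen.mem_nhds hp] with q hq using h.left_inv q hq
    exact hasMFDerivAt_unique h1 h2

omit [IsManifold I ∞ N] [IsManifold I 1 N] [CompleteSpace A] in
lemma isInvertible_mvfderiv (h : IsCoordSystem I φ ψ U) {p : N} (hp : p ∈ U) :
    (mvfderiv I φ p).IsInvertible :=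
  h.isInvertible hp

omit [IsManifold I ∞ N] [IsManifold I 1 N] [CompleteSpace A] in
lemma mvfderiv_inverse (h : IsCoordSystem I φ ψ U) {p : N} (hp : p ∈ U) (w : F) :
    mvfderiv I φ p ((mvfderiv I φ p).inverse w) = w := by
  obtain ⟨L, hL⟩ := h.isInvertible_mvfderiv hp
  rw [← hL]
  simp

omit [IsManifold I ∞ N] [IsManifold I 1 N] [CompleteSpace A] in
lemma inverse_mvfderiv (h : IsCoordSystem I φ ψ U) {p : N} (hp : p ∈ U) (v : TangentSpace I p) :
    (mvfderiv I φ p).inverse (mvfderiv I φ p v) = v := by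
  obtain ⟨L, hL⟩ := h.isInvertible_mvfderiv hp
  rw [← hL]
  simp

omit [IsManifold I ∞ N] [IsManifold I 1 N] [CompleteSpace A] in
lemma injective (h : IsCoordSystem I φ ψ U) {p : N} (hp : p ∈ U) {v w : TangentSpace I p}
    (hvw : mvfderiv I φ p v = mvfderiv I φ p w) : v = w := by
  rw [← h.inverse_mvfderiv hp v, hvw, h.inverse_mvfderiv hp]

omit [IsManifold I ∞ N] [IsManifold I 1 N] [CompleteSpace A] in
lemma vecDeriv_fieldOf (h : IsCoordSystem I φ ψ U) {p : N} (hp : p ∈ U) (g : N → F) :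
    vecDeriv I (fieldOf I φ g) φ p = g p :=
  h.mvfderiv_inverse hp (g p)

omit [IsManifold I ∞ N] in
-- Near `p` the field is the pullback along `φ` of the field `g ∘ ψ` on the vector space, and
-- pullback by a map with invertible derivative preserves smoothness.
lemma smoothAt_fieldOf (h : IsCoordSystem I φ ψ U) {p : N} (hp : p ∈ U) {g : N → F}
    (hg : ContMDiffAt I 𝓘(ℝ, F) ∞ g p) : SmoothAt I p (fieldOf I φ g) := by
  have h1 : ContMDiffAt 𝓘(ℝ, F) 𝓘(ℝ, F) ∞ (g ∘ ψ) (φ p) := by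
    refine ContMDiffAt.comp (φ p) ?_ (h.smooth_symm p hp)
    rwa [h.left_inv p hp]
  have h2 := contMDiffAt_vectorSpace_iff_contDiffAt (V := fun z => (g ∘ ψ) z).2 h1.contDiffAt
  have h3 := ContMDiffAt.mpullback_vectorField_preimage h2 (h.smooth p hp) (h.isInvertible hp)
    (by simp)
  refine SmoothAt.congr h3 ?_
  filter_upwards [h.isOpen.mem_nhds hp] with q hq
  have : (mvfderiv I φ q).inverse (g (ψ (φ q))) = (mvfderiv I φ q).inverse (g q) := by
    rw [h.left_inv q hq]
  exact this

omit [IsManifold I ∞ N] [IsManifold I 1 N] [CompleteSpace A] in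
lemma eq_fieldOf (h : IsCoordSystem I φ ψ U) {p : N} (hp : p ∈ U) (X : VField I N) :
    X p = fieldOf I φ (vecDeriv I X φ) p :=
  (h.inverse_mvfderiv hp (X p)).symm

omit [IsManifold I ∞ N] in
lemma smoothAt_of_vecDeriv (h : IsCoordSystem I φ ψ U) {p : N} (hp : p ∈ U) {X : VField I N}
    (hX : ContMDiffAt I 𝓘(ℝ, F) ∞ (vecDeriv I X φ) p) : SmoothAt I p X := by
  refine (h.smoothAt_fieldOf hp hX).congr ?_
  filter_upwards [h.isOpen.mem_nhds hp] with q hq using (h.eq_fieldOf hq X).symm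

/-- In a coordinate system, the components of `[X, Y]` are `X(Y^i) - Y(X^i)`. -/
lemma vecDeriv_bracket (h : IsCoordSystem I φ ψ U) {p : N} (hp : p ∈ U) {X Y : VField I N}
    (hX : SmoothAt I p X) (hY : SmoothAt I p Y) :
    vecDeriv I (SODEGeometry.bracket I X Y) φ p =
      vecDeriv I X (vecDeriv I Y φ) p - vecDeriv I Y (vecDeriv I X φ) p := by
  have key : ∀ Z : VField I N, SmoothAt I p Z →
      ContDiffAt ℝ ∞ (vecDeriv I Z φ ∘ ψ) (φ p) := by
    intro Z hZ
    refine ContMDiffAt.contDiffAt (ContMDiffAt.comp (φ p) ?_ (h.smooth_symm p hp))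
    rw [h.left_inv p hp]
    exact hZ.vecDeriv (h.smooth p hp)
  -- Every field is locally the pullback of its own component function, so naturality of the bracket
  -- under pullback moves the computation to the vector space `F`.
  have pull : ∀ Z : VField I N, Z =ᶠ[𝓝 p]
      VectorField.mpullback I 𝓘(ℝ, F) φ (fun z => (vecDeriv I Z φ ∘ ψ) z) := by
    intro Z
    filter_upwards [h.isOpen.mem_nhds hp] with q hq
    have : Z q = (mvfderiv I φ q).inverse (vecDeriv I Z φ (ψ (φ q))) := by
      rw [h.left_inv q hq]
      exact h.eq_fieldOf hq Z
    exact this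
  -- Transported back by the chain rule, the ordinary derivatives occurring in the flat bracket are
  -- derivatives along `Z` on the manifold.
  have deriv : ∀ Z W : VField I N, SmoothAt I p W →
      fderiv ℝ (vecDeriv I W φ ∘ ψ) (φ p) ((vecDeriv I Z φ ∘ ψ) (φ p)) =
        vecDeriv I Z (vecDeriv I W φ) p := by
    intro Z W hW
    rw [Function.comp_apply, h.left_inv p hp, ← vecDeriv_fderiv_comp Z
      ((key W hW).differentiableAt (by simp)) ((h.smooth p hp).mdifferentiableAt (by simp))]
    refine vecDeriv_congr rfl ?_
    filter_upwards [h.isOpen.mem_nhds hp] with q hq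
    rw [Function.comp_apply, h.left_inv q hq]
  have : IsManifold I (minSmoothness ℝ 2) N := by
    simpa using isManifold_two_of_smooth (I := I) (N := N)
  have main := VectorField.mpullback_mlieBracket (I := I) (n := ∞)
    (contMDiffAt_vectorSpace_iff_contDiffAt.2 (key X hX) |>.mdifferentiableAt (by simp))
    (contMDiffAt_vectorSpace_iff_contDiffAt.2 (key Y hY) |>.mdifferentiableAt (by simp))
    (h.smooth p hp) (by simpa using ENat.LEInfty.out (m := 2))
  rw [← (pull X).mlieBracket_vectorField_eq (pull Y)] at main
  have e1 : vecDeriv I (SODEGeometry.bracket I X Y) φ p =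
      VectorField.mlieBracket 𝓘(ℝ, F) (fun z => (vecDeriv I X φ ∘ ψ) z)
        (fun z => (vecDeriv I Y φ ∘ ψ) z) (φ p) := by
    have := h.mvfderiv_inverse hp (VectorField.mlieBracket 𝓘(ℝ, F)
      (fun z => (vecDeriv I X φ ∘ ψ) z) (fun z => (vecDeriv I Y φ ∘ ψ) z) (φ p))
    refine Eq.trans ?_ this
    exact congrArg (mvfderiv I φ p) main.symm
  rw [e1, ← deriv X Y hY, ← deriv Y X hX]
  exact mlieBracket_vectorSpace _ _ _

end IsCoordSystem

end General

end SODEGeometry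

end

/-! ### Adapted coordinates on the evolution space -/

noncomputable section

namespace SODEGeometry

variable {n : ℕ} {M : Type*} [TopologicalSpace M] [ChartedSpace (Rn n) M]

/-- The inverse of the adapted coordinates. -/
def coordsSymm (e : OpenPartialHomeomorph M (Rn n)) (z : ℝ × Rn n × Rn n) : Evo n M :=
  (z.1, ⟨e.symm z.2.1, mfderiv (𝓡 n) (𝓡 n) e.symm z.2.1 z.2.2⟩)

variable [IsManifold (𝓡 n) ∞ M]

/-- The chart is smooth only on its source, so smoothness is first obtained for the tangent map
within that open set, where the two tangent maps coincide. -/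
lemma contMDiffAt_tangentMap {e : OpenPartialHomeomorph M (Rn n)}
    (he : e ∈ IsManifold.maximalAtlas (𝓡 n) ∞ M) {v : TangentBundle (𝓡 n) M}
    (hv : v.proj ∈ e.source) :
    ContMDiffAt (𝓡 n).tangent (𝓡 n).tangent ∞ (tangentMap (𝓡 n) (𝓡 n) e) v := by
  have h1 := (contMDiffOn_of_mem_maximalAtlas he).contMDiffOn_tangentMapWithin
    (m := ∞) (by simp) e.open_source.uniqueMDiffOn
  have hO : IsOpen (Bundle.TotalSpace.proj ⁻¹' e.source : Set (TangentBundle (𝓡 n) M)) :=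
    e.open_source.preimage (FiberBundle.continuous_proj _ _)
  refine (h1.contMDiffAt (hO.mem_nhds hv)).congr_of_eventuallyEq ?_
  filter_upwards [hO.mem_nhds hv] with w hw
  exact (tangentMapWithin_eq_tangentMap (e.open_source.uniqueMDiffOn _ hw)
    (((contMDiffOn_of_mem_maximalAtlas he).contMDiffAt
      (e.open_source.mem_nhds hw)).mdifferentiableAt (by simp))).symm

lemma contMDiffAt_tangentMap_symm {e : OpenPartialHomeomorph M (Rn n)}
    (he : e ∈ IsManifold.maximalAtlas (𝓡 n) ∞ M) {v : TangentBundle (𝓡 n) (Rn n)}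
    (hv : v.proj ∈ e.target) :
    ContMDiffAt (𝓡 n).tangent (𝓡 n).tangent ∞ (tangentMap (𝓡 n) (𝓡 n) e.symm) v := by
  have h1 := (contMDiffOn_symm_of_mem_maximalAtlas he).contMDiffOn_tangentMapWithin
    (m := ∞) (by simp) e.open_target.uniqueMDiffOn
  have hO : IsOpen (Bundle.TotalSpace.proj ⁻¹' e.target : Set (TangentBundle (𝓡 n) (Rn n))) :=
    e.open_target.preimage (FiberBundle.continuous_proj _ _)
  refine (h1.contMDiffAt (hO.mem_nhds hv)).congr_of_eventuallyEq ?_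
  filter_upwards [hO.mem_nhds hv] with w hw
  exact (tangentMapWithin_eq_tangentMap (e.open_target.uniqueMDiffOn _ hw)
    (((contMDiffOn_symm_of_mem_maximalAtlas he).contMDiffAt
      (e.open_target.mem_nhds hw)).mdifferentiableAt (by simp))).symm

lemma isOpen_adaptedDomain (e : OpenPartialHomeomorph M (Rn n)) :
    IsOpen (adaptedDomain e : Set (Evo n M)) :=
  e.open_source.preimage ((FiberBundle.continuous_proj _ _).comp continuous_snd)

omit [IsManifold (𝓡 n) ∞ M] in
lemma mdifferentiable_of_mem_maximalAtlas {e : OpenPartialHomeomorph M (Rn n)}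
    (he : e ∈ IsManifold.maximalAtlas (𝓡 n) ∞ M) : e.MDifferentiable (𝓡 n) (𝓡 n) :=
  ⟨(contMDiffOn_of_mem_maximalAtlas he).mdifferentiableOn (by simp),
    (contMDiffOn_symm_of_mem_maximalAtlas he).mdifferentiableOn (by simp)⟩

lemma contMDiff_base : ContMDiff (IE n) (𝓡 n) ∞ (fun q : Evo n M => q.2.proj) :=
  (Bundle.contMDiff_proj (TangentSpace (𝓡 n))).comp contMDiff_snd

/-- The adapted coordinates are the identity in `t` times the tangent map of `e`. Both inverse laws
are the chain rule for `e` and `e.symm`. -/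
lemma isCoordSystem_coords {e : OpenPartialHomeomorph M (Rn n)}
    (he : e ∈ IsManifold.maximalAtlas (𝓡 n) ∞ M) :
    IsCoordSystem (IE n) (coords e) (coordsSymm e) (adaptedDomain e : Set (Evo n M)) where
  isOpen := isOpen_adaptedDomain e
  smooth p hp := by
    have h1 : ContMDiffAt (IE n) (𝓡 n).tangent ∞
        (fun q : Evo n M => tangentMap (𝓡 n) (𝓡 n) e q.2) p :=
      (contMDiffAt_tangentMap he hp).comp p contMDiffAt_snd
    have h2 := (contMDiff_snd_tangentBundle_modelSpace (Rn n) (𝓡 n)).contMDiffAt.comp p h1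
    have h3 := (Bundle.contMDiff_proj (TangentSpace (𝓡 n))).contMDiffAt.comp p h1
    exact contMDiffAt_fst.prodMk_space (h3.prodMk_space h2)
  smooth_symm p hp := by
    have hz : (coords e p).2.1 ∈ e.target := e.map_source hp
    have h1 : ContMDiffAt 𝓘(ℝ, ℝ × Rn n × Rn n) (𝓡 n).tangent ∞
        (fun z : ℝ × Rn n × Rn n => (⟨z.2.1, z.2.2⟩ : TangentBundle (𝓡 n) (Rn n)))
        (coords e p) := by
      refine (Bundle.contMDiffAt_totalSpace).2 ⟨?_, ?_⟩
      · exact ContDiffAt.contMDiffAt (by fun_prop)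
      · simp
        exact ContDiffAt.contMDiffAt (by fun_prop)
    have h2 := (contMDiffAt_tangentMap_symm (v := ⟨(coords e p).2.1, (coords e p).2.2⟩)
      he hz).comp (coords e p) h1
    have h0 : ContMDiffAt 𝓘(ℝ, ℝ × Rn n × Rn n) 𝓘(ℝ, ℝ) ∞
      (fun z : ℝ × Rn n × Rn n => z.1) (coords e p) := ContDiffAt.contMDiffAt (by fun_prop)
    exact h0.prodMk h2
  left_inv p hp := by
    have h := (mdifferentiable_of_mem_maximalAtlas he).symm_comp_deriv hp
    obtain ⟨t, x, u⟩ := p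
    have hx : e.symm (e x) = x := e.left_inv hp
    have h' := congrArg (fun L => L u) h
    exact Prod.ext rfl (Bundle.TotalSpace.ext hx (heq_of_eq h'))
  right_inv p hp := by
    have hz : (coords e p).2.1 ∈ e.target := e.map_source hp
    have : ∀ᶠ z : ℝ × Rn n × Rn n in 𝓝 (coords e p), z.2.1 ∈ e.target :=
      (e.open_target.preimage (continuous_fst.comp continuous_snd)).mem_nhds hz
    filter_upwards [this] with z hz
    have h := (mdifferentiable_of_mem_maximalAtlas he).comp_symm_deriv hz
    have h' := congrArg (fun L => L z.2.2) h
    obtain ⟨t, x, u⟩ := z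
    have h3 : e (e.symm x) = x := e.right_inv hz
    refine Prod.ext rfl (Prod.ext h3 h')

/-- The velocity coordinates `(uⁱ)`. -/
def velocity (e : OpenPartialHomeomorph M (Rn n)) (p : Evo n M) : Rn n := (coords e p).2.2

section

variable {e : OpenPartialHomeomorph M (Rn n)} {p : Evo n M}

lemma mdifferentiableAt_coords (he : e ∈ IsManifold.maximalAtlas (𝓡 n) ∞ M)
    (hp : p ∈ adaptedDomain e) :
    MDifferentiableAt (IE n) 𝓘(ℝ, ℝ × Rn n × Rn n) (coords e) p :=
  ((isCoordSystem_coords he).smooth p hp).mdifferentiableAt (by simp)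

lemma dcoords_fst (he : e ∈ IsManifold.maximalAtlas (𝓡 n) ∞ M) (hp : p ∈ adaptedDomain e)
    (v : TangentSpace (IE n) p) : (dcoords e p v).1 = dt p v := by
  have h := vecDeriv_clm (fun _ => v : VField (IE n) (Evo n M))
    (ContinuousLinearMap.fst ℝ ℝ (Rn n × Rn n)) (mdifferentiableAt_coords he hp)
  exact h.symm

lemma dcoords_snd_fst (he : e ∈ IsManifold.maximalAtlas (𝓡 n) ∞ M) (hp : p ∈ adaptedDomain e)
    (v : TangentSpace (IE n) p) :
    (dcoords e p v).2.1 = mfderiv (𝓡 n) (𝓡 n) e p.2.proj (dx p v) := by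
  have h := vecDeriv_clm (fun _ => v : VField (IE n) (Evo n M))
    ((ContinuousLinearMap.fst ℝ (Rn n) (Rn n)).comp
      (ContinuousLinearMap.snd ℝ ℝ (Rn n × Rn n))) (mdifferentiableAt_coords he hp)
  refine h.symm.trans ?_
  have h1 : MDifferentiableAt (𝓡 n) (𝓡 n) e p.2.proj :=
    (mdifferentiable_of_mem_maximalAtlas he).mdifferentiableAt hp
  have h2 := mfderiv_comp p h1 (contMDiff_base.contMDiffAt.mdifferentiableAt (by simp) :
    MDifferentiableAt (IE n) (𝓡 n) (fun q : Evo n M => q.2.proj) p)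
  exact congrArg (fun L => L v) h2

lemma mdifferentiableAt_fibre (p : Evo n M) (w₀ : Rn n) :
    MDifferentiableAt 𝓘(ℝ, Rn n) (IE n)
      (fun w : Rn n => ((p.1, ⟨p.2.proj, w⟩) : Evo n M)) w₀ := by
  have h : ContMDiffAt 𝓘(ℝ, Rn n) (𝓡 n).tangent ∞
      (fun w : Rn n => (⟨p.2.proj, w⟩ : TangentBundle (𝓡 n) M)) w₀ := by
    refine (Bundle.contMDiffAt_totalSpace).2 ⟨contMDiffAt_const, ?_⟩
    refine contMDiffAt_id.congr_of_eventuallyEq (Filter.Eventually.of_forall fun w => ?_)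
    -- In the trivialization centred at the base point itself, the fibre inclusion reads `w ↦ w`.
    exact (tangentBundleCore (𝓡 n) M).coordChange_self (achart (Rn n) p.2.proj) p.2.proj
      (mem_chart_source _ _) w
  exact (contMDiffAt_const.prodMk h).mdifferentiableAt (by simp)

/-- In coordinates the fibre inclusion is the affine map `w ↦ (t, e x, L w)`, with `L` the
derivative of `e` at the base point. -/
lemma dcoords_vlift (he : e ∈ IsManifold.maximalAtlas (𝓡 n) ∞ M) (hp : p ∈ adaptedDomain e)
    (w : TangentSpace (𝓡 n) p.2.proj) :
    dcoords e p (vlift p w) = (0, 0, mfderiv (𝓡 n) (𝓡 n) e p.2.proj w) := by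
  have h1 : HasMFDerivAt (IE n) 𝓘(ℝ, ℝ × Rn n × Rn n) (coords e)
      ((p.1, ⟨p.2.proj, p.2.2⟩) : Evo n M) (dcoords e p) :=
    (mdifferentiableAt_coords he hp).hasMFDerivAt
  have h2 := HasMFDerivAt.comp (M := Rn n) p.2.2 h1 (mdifferentiableAt_fibre p p.2.2).hasMFDerivAt
  let L : Rn n →L[ℝ] Rn n := mfderiv (𝓡 n) (𝓡 n) e p.2.proj
  have h3 : HasFDerivAt (fun w : Rn n => ((p.1, e p.2.proj, L w) : ℝ × Rn n × Rn n))
      ((0 : Rn n →L[ℝ] ℝ).prod ((0 : Rn n →L[ℝ] Rn n).prod L)) p.2.2 :=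
    (hasFDerivAt_const _ _).prodMk ((hasFDerivAt_const _ _).prodMk L.hasFDerivAt)
  have h4 := hasMFDerivAt_unique h2 h3.hasMFDerivAt
  exact congrArg (fun L => L w) h4

lemma dcoords_vertEndo (he : e ∈ IsManifold.maximalAtlas (𝓡 n) ∞ M) (hp : p ∈ adaptedDomain e)
    (v : TangentSpace (IE n) p) :
    dcoords e p (vertEndo n M p v) =
      (0, 0, (dcoords e p v).2.1 - (dcoords e p v).1 • velocity e p) := by
  have h := dcoords_vlift he hp (contact p v)
  have h1 : mfderiv (𝓡 n) (𝓡 n) e p.2.proj (contact p v) =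
      (dcoords e p v).2.1 - (dcoords e p v).1 • velocity e p := by
    rw [dcoords_fst he hp, dcoords_snd_fst he hp]
    have : contact p v = dx p v - dt p v • p.2.2 := rfl
    rw [this, map_sub, map_smul]
    rfl
  rw [← h1]
  exact h

lemma mem_vertSpace_iff (he : e ∈ IsManifold.maximalAtlas (𝓡 n) ∞ M) (hp : p ∈ adaptedDomain e)
    (v : TangentSpace (IE n) p) :
    v ∈ vertSpace p ↔ (dcoords e p v).1 = 0 ∧ (dcoords e p v).2.1 = 0 := by
  rw [dcoords_fst he hp, dcoords_snd_fst he hp]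
  have h := mfderiv_prodMk (x := p)
    ((contMDiffAt_fst (n := ∞)).mdifferentiableAt (by simp) :
      MDifferentiableAt (IE n) 𝓘(ℝ, ℝ) (fun q : Evo n M => q.1) p)
    (contMDiff_base.contMDiffAt.mdifferentiableAt (by simp) :
      MDifferentiableAt (IE n) (𝓡 n) (fun q : Evo n M => q.2.proj) p)
  have h1 : v ∈ vertSpace p ↔ dt p v = 0 ∧ dx p v = 0 := by
    have : v ∈ vertSpace p ↔ mfderiv (IE n) (𝓘(ℝ, ℝ).prod (𝓡 n))
      (fun q : Evo n M => ((q.1, q.2.proj) : ℝ × M)) p v = 0 := Iff.rfl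
    rw [this, h]
    exact Prod.ext_iff
  rw [h1]
  have inj := (mdifferentiable_of_mem_maximalAtlas he).mfderiv_injective hp
  refine and_congr_right fun _ => ⟨fun hv => by rw [hv]; exact map_zero _, fun hv => inj ?_⟩
  rw [map_zero]
  exact hv

lemma contMDiffAt_velocity (he : e ∈ IsManifold.maximalAtlas (𝓡 n) ∞ M)
    (hp : p ∈ adaptedDomain e) : ContMDiffAt (IE n) 𝓘(ℝ, Rn n) ∞ (velocity e) p :=
  ((ContinuousLinearMap.snd ℝ (Rn n) (Rn n)).comp
    (ContinuousLinearMap.snd ℝ ℝ (Rn n × Rn n))).contMDiff.contMDiffAt.comp p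
    ((isCoordSystem_coords he).smooth p hp)

lemma dcoords_injective (he : e ∈ IsManifold.maximalAtlas (𝓡 n) ∞ M) (hp : p ∈ adaptedDomain e)
    {v w : TangentSpace (IE n) p} (h : dcoords e p v = dcoords e p w) : v = w :=
  (isCoordSystem_coords he).injective hp h

lemma dcoords_fieldOf (he : e ∈ IsManifold.maximalAtlas (𝓡 n) ∞ M) (hp : p ∈ adaptedDomain e)
    (g : Evo n M → ℝ × Rn n × Rn n) :
    dcoords e p (fieldOf (IE n) (coords e) g p) = g p :=
  (isCoordSystem_coords he).vecDeriv_fieldOf hp g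

lemma IsSODE.dcoords_fst {Γ : VField (IE n) (Evo n M)} (hΓ : IsSODE Γ)
    (he : e ∈ IsManifold.maximalAtlas (𝓡 n) ∞ M) (hp : p ∈ adaptedDomain e) :
    (dcoords e p (Γ p)).1 = 1 := by
  rw [SODEGeometry.dcoords_fst he hp, hΓ.dt_eq]

lemma IsSODE.dcoords_snd_fst {Γ : VField (IE n) (Evo n M)} (hΓ : IsSODE Γ)
    (he : e ∈ IsManifold.maximalAtlas (𝓡 n) ∞ M) (hp : p ∈ adaptedDomain e) :
    (dcoords e p (Γ p)).2.1 = velocity e p := by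
  rw [SODEGeometry.dcoords_snd_fst he hp, hΓ.dx_eq]
  rfl

end

end SODEGeometry

end

noncomputable section

namespace SODEGeometry

/-! ### Eigenprojectors of an endomorphism with `L³ = L` -/

section Cubic

open Module.End

variable {W : Type*} [AddCommGroup W] [Module ℝ W] {L : W →ₗ[ℝ] W}

/-- Eigenspaces for distinct eigenvalues are independent, so exhibiting a splitting of every vector
both proves complementarity and identifies the projection. -/
lemma eigenProj_apply_of_decomp {μ : ℝ} {T : W → W} (h1 : ∀ v, T v ∈ eigenspace L μ)
    (h2 : ∀ v, v - T v ∈ ⨆ ν : {ν : ℝ // ν ≠ μ}, eigenspace L ν) (v : W) :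
    eigenProj L μ v = T v := by
  have hc : IsCompl (eigenspace L μ) (⨆ ν : {ν : ℝ // ν ≠ μ}, eigenspace L ν) := by
    constructor
    · have h := eigenspaces_iSupIndep L μ
      rwa [iSup_subtype'] at h
    · rw [codisjoint_iff, eq_top_iff]
      intro v _
      exact Submodule.mem_sup.2 ⟨T v, h1 v, v - T v, h2 v, by abel⟩
  rw [eigenProj, dif_pos hc]
  conv_lhs => rw [show v = T v + (v - T v) by abel]
  rw [map_add, Submodule.projection_apply_left hc ⟨T v, h1 v⟩,
    (Submodule.projection_apply_eq_zero_iff hc).2 (h2 v), add_zero]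

/-- The candidates here and in the next two lemmas are the Lagrange polynomials `1 - x²`, `(x² +
x)/2`, `(x² - x)/2` for the roots `0, 1, -1` of `x³ - x`; they sum to `1`. -/
lemma sub_sq_mem_eigenspace_zero (hL : ∀ v, L (L (L v)) = L v) (v : W) :
    v - L (L v) ∈ eigenspace L 0 := by
  rw [mem_eigenspace_iff, map_sub, hL, sub_self, zero_smul]

lemma half_sq_add_mem_eigenspace_one (hL : ∀ v, L (L (L v)) = L v) (v : W) :
    (1 / 2 : ℝ) • (L (L v) + L v) ∈ eigenspace L 1 := by
  rw [mem_eigenspace_iff, map_smul, map_add, hL, one_smul, add_comm]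

lemma half_sq_sub_mem_eigenspace_neg_one (hL : ∀ v, L (L (L v)) = L v) (v : W) :
    (1 / 2 : ℝ) • (L (L v) - L v) ∈ eigenspace L (-1) := by
  rw [mem_eigenspace_iff, map_smul, map_sub, hL]
  module

lemma mem_iSup_eigenspace_ne {μ ν : ℝ} (h : ν ≠ μ) {v : W} (hv : v ∈ eigenspace L ν) :
    v ∈ ⨆ ν : {ν : ℝ // ν ≠ μ}, eigenspace L ν :=
  Submodule.mem_iSup_of_mem (p := fun ν : {ν : ℝ // ν ≠ μ} => eigenspace L ν) ⟨ν, h⟩ hv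

lemma eigenProj_zero (hL : ∀ v, L (L (L v)) = L v) (v : W) : eigenProj L 0 v = v - L (L v) := by
  refine eigenProj_apply_of_decomp (sub_sq_mem_eigenspace_zero hL) (fun v => ?_) v
  have h1 := mem_iSup_eigenspace_ne (μ := 0) (by norm_num) (half_sq_add_mem_eigenspace_one hL v)
  have h2 := mem_iSup_eigenspace_ne (μ := 0) (by norm_num)
    (half_sq_sub_mem_eigenspace_neg_one hL v)
  convert Submodule.add_mem _ h1 h2 using 1
  module

lemma eigenProj_one (hL : ∀ v, L (L (L v)) = L v) (v : W) :
    eigenProj L 1 v = (1 / 2 : ℝ) • (L (L v) + L v) := by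
  refine eigenProj_apply_of_decomp (half_sq_add_mem_eigenspace_one hL) (fun v => ?_) v
  have h1 := mem_iSup_eigenspace_ne (μ := 1) (by norm_num) (sub_sq_mem_eigenspace_zero hL v)
  have h2 := mem_iSup_eigenspace_ne (μ := 1) (by norm_num)
    (half_sq_sub_mem_eigenspace_neg_one hL v)
  convert Submodule.add_mem _ h1 h2 using 1
  module

lemma eigenProj_neg_one (hL : ∀ v, L (L (L v)) = L v) (v : W) :
    eigenProj L (-1) v = (1 / 2 : ℝ) • (L (L v) - L v) := by
  refine eigenProj_apply_of_decomp (half_sq_sub_mem_eigenspace_neg_one hL) (fun v => ?_) v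
  have h1 := mem_iSup_eigenspace_ne (μ := -1) (by norm_num) (sub_sq_mem_eigenspace_zero hL v)
  have h2 := mem_iSup_eigenspace_ne (μ := -1) (by norm_num)
    (half_sq_add_mem_eigenspace_one hL v)
  convert Submodule.add_mem _ h1 h2 using 1
  module

lemma isInternal_eigenspace (hL : ∀ v, L (L (L v)) = L v) :
    DirectSum.IsInternal (fun k : Fin 3 => eigenspace L ((![0, 1, -1] : Fin 3 → ℝ) k)) := by
  refine DirectSum.isInternal_submodule_of_iSupIndep_of_iSup_eq_top
    ((eigenspaces_iSupIndep L).comp ?_) ?_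
  · intro i j h
    fin_cases i <;> fin_cases j <;> first | rfl | (norm_num at h)
  · rw [eq_top_iff]
    intro v _
    have h0 := Submodule.mem_iSup_of_mem
      (p := fun k : Fin 3 => eigenspace L ((![0, 1, -1] : Fin 3 → ℝ) k)) 0
      (sub_sq_mem_eigenspace_zero hL v)
    have h1 := Submodule.mem_iSup_of_mem
      (p := fun k : Fin 3 => eigenspace L ((![0, 1, -1] : Fin 3 → ℝ) k)) 1
      (half_sq_add_mem_eigenspace_one hL v)
    have h2 := Submodule.mem_iSup_of_mem
      (p := fun k : Fin 3 => eigenspace L ((![0, 1, -1] : Fin 3 → ℝ) k)) 2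
      (half_sq_sub_mem_eigenspace_neg_one hL v)
    convert Submodule.add_mem _ h0 (Submodule.add_mem _ h1 h2) using 1
    module

end Cubic

/-! ### Componentwise derivatives and smoothness in adapted coordinates -/

variable {n : ℕ} {M : Type*} [TopologicalSpace M] [ChartedSpace (Rn n) M]
  [IsManifold (𝓡 n) ∞ M]

section Components

variable {e : OpenPartialHomeomorph M (Rn n)} {p : Evo n M} {f : Evo n M → ℝ × Rn n × Rn n}
  (X : VField (IE n) (Evo n M))

lemma vecDeriv_fst (hf : MDifferentiableAt (IE n) 𝓘(ℝ, ℝ × Rn n × Rn n) f p) :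
    (vecDeriv (IE n) X f p).1 = vecDeriv (IE n) X (fun q => (f q).1) p :=
  (vecDeriv_clm X (ContinuousLinearMap.fst ℝ ℝ (Rn n × Rn n)) hf).symm

lemma vecDeriv_snd_fst (hf : MDifferentiableAt (IE n) 𝓘(ℝ, ℝ × Rn n × Rn n) f p) :
    (vecDeriv (IE n) X f p).2.1 = vecDeriv (IE n) X (fun q => (f q).2.1) p :=
  (vecDeriv_clm X ((ContinuousLinearMap.fst ℝ (Rn n) (Rn n)).comp
    (ContinuousLinearMap.snd ℝ ℝ (Rn n × Rn n))) hf).symm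

lemma vecDeriv_snd_snd (hf : MDifferentiableAt (IE n) 𝓘(ℝ, ℝ × Rn n × Rn n) f p) :
    (vecDeriv (IE n) X f p).2.2 = vecDeriv (IE n) X (fun q => (f q).2.2) p :=
  (vecDeriv_clm X ((ContinuousLinearMap.snd ℝ (Rn n) (Rn n)).comp
    (ContinuousLinearMap.snd ℝ ℝ (Rn n × Rn n))) hf).symm

lemma vecDeriv_velocity (he : e ∈ IsManifold.maximalAtlas (𝓡 n) ∞ M) (hp : p ∈ adaptedDomain e) :
    vecDeriv (IE n) X (velocity e) p = (dcoords e p (X p)).2.2 :=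
  (vecDeriv_snd_snd X (mdifferentiableAt_coords he hp)).symm

variable {X}

lemma contMDiffAt_components (he : e ∈ IsManifold.maximalAtlas (𝓡 n) ∞ M)
    (hp : p ∈ adaptedDomain e) (hX : SmoothAt (IE n) p X) :
    ContMDiffAt (IE n) 𝓘(ℝ, ℝ × Rn n × Rn n) ∞ (fun q => dcoords e q (X q)) p :=
  hX.vecDeriv ((isCoordSystem_coords he).smooth p hp)

lemma contMDiffAt_fst_component (hf : ContMDiffAt (IE n) 𝓘(ℝ, ℝ × Rn n × Rn n) ∞ f p) :
    ContMDiffAt (IE n) 𝓘(ℝ, ℝ) ∞ (fun q => (f q).1) p :=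
  (ContinuousLinearMap.fst ℝ ℝ (Rn n × Rn n)).contMDiff.contMDiffAt.comp p hf

lemma contMDiffAt_snd_fst_component (hf : ContMDiffAt (IE n) 𝓘(ℝ, ℝ × Rn n × Rn n) ∞ f p) :
    ContMDiffAt (IE n) 𝓘(ℝ, Rn n) ∞ (fun q => (f q).2.1) p :=
  ((ContinuousLinearMap.fst ℝ (Rn n) (Rn n)).comp
    (ContinuousLinearMap.snd ℝ ℝ (Rn n × Rn n))).contMDiff.contMDiffAt.comp p hf

lemma contMDiffAt_snd_snd_component (hf : ContMDiffAt (IE n) 𝓘(ℝ, ℝ × Rn n × Rn n) ∞ f p) :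
    ContMDiffAt (IE n) 𝓘(ℝ, Rn n) ∞ (fun q => (f q).2.2) p :=
  ((ContinuousLinearMap.snd ℝ (Rn n) (Rn n)).comp
    (ContinuousLinearMap.snd ℝ ℝ (Rn n × Rn n))).contMDiff.contMDiffAt.comp p hf

lemma smoothAt_of_components (he : e ∈ IsManifold.maximalAtlas (𝓡 n) ∞ M)
    (hp : p ∈ adaptedDomain e)
    (hX : ContMDiffAt (IE n) 𝓘(ℝ, ℝ × Rn n × Rn n) ∞ (fun q => dcoords e q (X q)) p) :
    SmoothAt (IE n) p X :=
  (isCoordSystem_coords he).smoothAt_of_vecDeriv hp hX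

lemma eventually_mem_adaptedDomain (hp : p ∈ adaptedDomain e) :
    ∀ᶠ q in 𝓝 p, q ∈ adaptedDomain e :=
  (isOpen_adaptedDomain e).mem_nhds hp

lemma dcoords_bracket (he : e ∈ IsManifold.maximalAtlas (𝓡 n) ∞ M) (hp : p ∈ adaptedDomain e)
    {Y : VField (IE n) (Evo n M)} (hX : SmoothAt (IE n) p X) (hY : SmoothAt (IE n) p Y) :
    dcoords e p (bracket (IE n) X Y p) =
      vecDeriv (IE n) X (fun q => dcoords e q (Y q)) p -
        vecDeriv (IE n) Y (fun q => dcoords e q (X q)) p :=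
  (isCoordSystem_coords he).vecDeriv_bracket hp hX hY

lemma smoothAt_vertEndo {Y : VField (IE n) (Evo n M)} (hY : SmoothAt (IE n) p Y) :
    SmoothAt (IE n) p ((vertEndo n M).on Y) := by
  have he := IsManifold.chart_mem_maximalAtlas (I := 𝓡 n) (n := ∞) p.2.proj
  have hp : p ∈ adaptedDomain (chartAt (Rn n) p.2.proj) := mem_chart_source _ _
  refine smoothAt_of_components he hp ?_
  have hy := contMDiffAt_components he hp hY
  refine ((contMDiffAt_const (c := (0 : ℝ))).prodMk_space
    ((contMDiffAt_const (c := (0 : Rn n))).prodMk_space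
    ((contMDiffAt_snd_fst_component hy).sub ((contMDiffAt_fst_component hy).smul
      (contMDiffAt_velocity he hp))))).congr_of_eventuallyEq ?_
  filter_upwards [eventually_mem_adaptedDomain hp] with q hq
  exact dcoords_vertEndo he hq _

end Components

/-! ### The coordinate expression of `𝓛_Γ S` -/

section SODE

variable (Γ : VField (IE n) (Evo n M)) (e : OpenPartialHomeomorph M (Rn n))

/-- The vector `F` of the right-hand sides of the equations. -/
def forceVec (p : Evo n M) : Rn n := (dcoords e p (Γ p)).2.2

/-- The linear map `b ↦ bʲ ∂F/∂uʲ`. -/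
def forceDeriv (p : Evo n M) : Rn n →L[ℝ] Rn n :=
  (mvfderiv (IE n) (forceVec Γ e) p).comp
    ((dcoords e p).inverse.comp ((ContinuousLinearMap.inr ℝ ℝ (Rn n × Rn n)).comp
      (ContinuousLinearMap.inr ℝ (Rn n) (Rn n))))

/-- The contact form `θⁱ` in coordinates. -/
def contactCoord (p : Evo n M) : ℝ × Rn n × Rn n →ₗ[ℝ] Rn n where
  toFun y := y.2.1 - y.1 • velocity e p
  map_add' y z := by simp; module
  map_smul' c y := by simp; module

/-- The coordinate expression of `𝓛_Γ S`. -/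
def deformCoord (p : Evo n M) : ℝ × Rn n × Rn n →ₗ[ℝ] ℝ × Rn n × Rn n where
  toFun y := (0, -contactCoord e p y,
    y.2.2 - y.1 • forceVec Γ e p - forceDeriv Γ e p (contactCoord e p y))
  map_add' y z := by simp [Prod.ext_iff]; constructor <;> module
  map_smul' c y := by simp [Prod.ext_iff]; module

variable {Γ e} {p : Evo n M}

omit [IsManifold (𝓡 n) ∞ M] in
lemma contactCoord_apply (y : ℝ × Rn n × Rn n) :
    contactCoord e p y = y.2.1 - y.1 • velocity e p := rfl

lemma deformCoord_apply (y : ℝ × Rn n × Rn n) :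
    deformCoord Γ e p y = (0, -contactCoord e p y,
      y.2.2 - y.1 • forceVec Γ e p - forceDeriv Γ e p (contactCoord e p y)) := rfl

/-- The first application leaves no `t`-component and changes the sign of `θ`, so in the second one
the two terms `Aθ` cancel. -/
lemma deformCoord_deformCoord (y : ℝ × Rn n × Rn n) :
    deformCoord Γ e p (deformCoord Γ e p y) =
      (0, contactCoord e p y, y.2.2 - y.1 • forceVec Γ e p) := by
  simp only [deformCoord_apply, contactCoord_apply, zero_smul, sub_zero, neg_neg, map_neg]
  simp
  module

lemma deformCoord_cubed (y : ℝ × Rn n × Rn n) :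
    deformCoord Γ e p (deformCoord Γ e p (deformCoord Γ e p y)) = deformCoord Γ e p y := by
  rw [deformCoord_deformCoord]
  simp [deformCoord_apply, contactCoord_apply]

lemma vecDeriv_forceVec (he : e ∈ IsManifold.maximalAtlas (𝓡 n) ∞ M) (hp : p ∈ adaptedDomain e)
    {X : VField (IE n) (Evo n M)} {b : Rn n} (hX : dcoords e p (X p) = (0, 0, b)) :
    vecDeriv (IE n) X (forceVec Γ e) p = forceDeriv Γ e p b := by
  have h : X p = (dcoords e p).inverse (0, 0, b) := by
    rw [← hX]
    exact ((isCoordSystem_coords he).inverse_mvfderiv hp (X p)).symm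
  exact congrArg (mvfderiv (IE n) (forceVec Γ e) p) h

variable (hΓ : IsSODE Γ) (he : e ∈ IsManifold.maximalAtlas (𝓡 n) ∞ M) (hp : p ∈ adaptedDomain e)
include hΓ

lemma IsSODE.smoothAt (p : Evo n M) : SmoothAt (IE n) p Γ :=
  hΓ.smooth.smoothAt isOpen_univ (Set.mem_univ p)

include he hp

lemma IsSODE.dcoords_eq : dcoords e p (Γ p) = (1, velocity e p, forceVec Γ e p) :=
  Prod.ext (hΓ.dcoords_fst he hp) (Prod.ext (hΓ.dcoords_snd_fst he hp) rfl)

lemma contMDiffAt_forceVec : ContMDiffAt (IE n) 𝓘(ℝ, Rn n) ∞ (forceVec Γ e) p :=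
  contMDiffAt_snd_snd_component (contMDiffAt_components he hp (hΓ.smoothAt p))

/-- This is where the second-order condition enters: the components of `Γ` are `(1, u, F)`, and
differentiating the coordinate `u` along `X` returns the last component of `X`. -/
lemma vecDeriv_dcoords_sode (X : VField (IE n) (Evo n M)) :
    vecDeriv (IE n) X (fun q => dcoords e q (Γ q)) p =
      (0, (dcoords e p (X p)).2.2, vecDeriv (IE n) X (forceVec Γ e) p) := by
  have hm := (contMDiffAt_components he hp (hΓ.smoothAt p)).mdifferentiableAt (by simp)
  have hq := eventually_mem_adaptedDomain hp
  refine Prod.ext ?_ (Prod.ext ?_ ?_)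
  · rw [vecDeriv_fst X hm, ← vecDeriv_const X (1 : ℝ) p]
    exact vecDeriv_congr rfl (hq.mono fun q hq => hΓ.dcoords_fst he hq)
  · rw [vecDeriv_snd_fst X hm, ← vecDeriv_velocity X he hp]
    exact vecDeriv_congr rfl (hq.mono fun q hq => hΓ.dcoords_snd_fst he hq)
  · rw [vecDeriv_snd_snd X hm]
    rfl

/-- Tensoriality by cancellation. The last component of `[Γ, S(Y)]` contains `Γ(y¹) - Γ(y⁰)u`, and
the same terms occur in `S([Γ, Y])`. The undifferentiated remainder comes from `Γ(u) = F`, from the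
`-y²` in the middle component of `[Γ, Y]`, and from differentiating `Γ` along `S(Y)`. -/
lemma deformCoord_dcoords {Y : VField (IE n) (Evo n M)} (hY : SmoothAt (IE n) p Y) :
    deformCoord Γ e p (dcoords e p (Y p)) =
      dcoords e p (bracket (IE n) Γ ((vertEndo n M).on Y) p -
        vertEndo n M p (bracket (IE n) Γ Y p)) := by
  have hG := hΓ.smoothAt p
  have hy := contMDiffAt_components he hp hY
  have hSy := contMDiffAt_components he hp (smoothAt_vertEndo hY)
  have hyd := hy.mdifferentiableAt (by simp)
  have hSyd := hSy.mdifferentiableAt (by simp)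
  have hdom := eventually_mem_adaptedDomain hp
  have hSp : dcoords e p ((vertEndo n M).on Y p) = (0, 0, contactCoord e p (dcoords e p (Y p))) :=
    dcoords_vertEndo he hp _
  have h0 : vecDeriv (IE n) Γ (fun q => dcoords e q ((vertEndo n M).on Y q)) p =
      (0, 0, vecDeriv (IE n) Γ
        (fun q => (dcoords e q (Y q)).2.1 - (dcoords e q (Y q)).1 • velocity e q) p) := by
    refine Prod.ext ?_ (Prod.ext ?_ ?_)
    · rw [vecDeriv_fst Γ hSyd]
      refine (vecDeriv_congr rfl ?_).trans (vecDeriv_const Γ (0 : ℝ) p)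
      exact hdom.mono fun q hq => congrArg Prod.fst (dcoords_vertEndo he hq (Y q))
    · rw [vecDeriv_snd_fst Γ hSyd]
      refine (vecDeriv_congr rfl ?_).trans (vecDeriv_const Γ (0 : Rn n) p)
      exact hdom.mono fun q hq => congrArg (fun z => z.2.1) (dcoords_vertEndo he hq (Y q))
    · rw [vecDeriv_snd_snd Γ hSyd]
      refine vecDeriv_congr rfl ?_
      exact hdom.mono fun q hq => congrArg (fun z => z.2.2) (dcoords_vertEndo he hq (Y q))
  have hy0 := (contMDiffAt_fst_component hy).mdifferentiableAt (by simp)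
  have hy1 := (contMDiffAt_snd_fst_component hy).mdifferentiableAt (by simp)
  have hu := (contMDiffAt_velocity he hp).mdifferentiableAt (by simp)
  have h1 : vecDeriv (IE n) Γ
      (fun q => (dcoords e q (Y q)).2.1 - (dcoords e q (Y q)).1 • velocity e q) p =
      vecDeriv (IE n) Γ (fun q => (dcoords e q (Y q)).2.1) p -
        ((dcoords e p (Y p)).1 • forceVec Γ e p +
        vecDeriv (IE n) Γ (fun q => (dcoords e q (Y q)).1) p • velocity e p) := by
    have hs : MDifferentiableAt (IE n) 𝓘(ℝ, Rn n)
        (fun q => (dcoords e q (Y q)).1 • velocity e q) p := hy0.smul hu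
    rw [vecDeriv_sub Γ hy1 hs, vecDeriv_smul Γ hy0 hu, vecDeriv_velocity Γ he hp]
    rfl
  have h2 : dcoords e p (bracket (IE n) Γ ((vertEndo n M).on Y) p) =
      (0, -contactCoord e p (dcoords e p (Y p)),
        vecDeriv (IE n) Γ (fun q => (dcoords e q (Y q)).2.1) p -
        ((dcoords e p (Y p)).1 • forceVec Γ e p +
        vecDeriv (IE n) Γ (fun q => (dcoords e q (Y q)).1) p • velocity e p) -
        forceDeriv Γ e p (contactCoord e p (dcoords e p (Y p)))) := by
    rw [dcoords_bracket he hp hG (smoothAt_vertEndo hY), h0, h1,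
      vecDeriv_dcoords_sode hΓ he hp, vecDeriv_forceVec he hp hSp, hSp]
    simp
  have h3 : dcoords e p (bracket (IE n) Γ Y p) =
      (vecDeriv (IE n) Γ (fun q => (dcoords e q (Y q)).1) p,
        vecDeriv (IE n) Γ (fun q => (dcoords e q (Y q)).2.1) p - (dcoords e p (Y p)).2.2,
        vecDeriv (IE n) Γ (fun q => (dcoords e q (Y q)).2.2) p -
          vecDeriv (IE n) Y (forceVec Γ e) p) := by
    rw [dcoords_bracket he hp hG hY, vecDeriv_dcoords_sode hΓ he hp, ← vecDeriv_fst Γ hyd,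
      ← vecDeriv_snd_fst Γ hyd, ← vecDeriv_snd_snd Γ hyd]
    simp [Prod.ext_iff]
  rw [map_sub, h2, dcoords_vertEndo he hp, h3, deformCoord_apply]
  refine Prod.ext (by simp) (Prod.ext (by simp) ?_)
  simp
  module

end SODE

end SODEGeometry

end

/-! ### The eigendistributions and their projectors -/

noncomputable section

namespace SODEGeometry

variable {n : ℕ} {M : Type*} [TopologicalSpace M] [ChartedSpace (Rn n) M]
  [IsManifold (𝓡 n) ∞ M]

lemma chartAt_mem_maximalAtlas (p : Evo n M) :
    chartAt (Rn n) p.2.proj ∈ IsManifold.maximalAtlas (𝓡 n) ∞ M :=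
  IsManifold.chart_mem_maximalAtlas _

omit [IsManifold (𝓡 n) ∞ M] in
lemma mem_adaptedDomain_chartAt (p : Evo n M) :
    p ∈ adaptedDomain (chartAt (Rn n) p.2.proj) :=
  mem_chart_source _ _

lemma sum_smul_single (a : Rn n) : ∑ i, a i • (EuclideanSpace.single i 1 : Rn n) = a := by
  ext k
  simp [Finset.sum_apply, Pi.single_apply]

lemma dcoords_inverse {e : OpenPartialHomeomorph M (Rn n)} {p : Evo n M}
    (he : e ∈ IsManifold.maximalAtlas (𝓡 n) ∞ M) (hp : p ∈ adaptedDomain e)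
    (y : ℝ × Rn n × Rn n) : dcoords e p ((dcoords e p).inverse y) = y :=
  (isCoordSystem_coords he).mvfderiv_inverse hp y

section Eigen

variable {Γ : VField (IE n) (Evo n M)} {e : OpenPartialHomeomorph M (Rn n)} {p : Evo n M}

/-- The coordinate expression of a linear map on the tangent space, read back on the latter. -/
def ofCoord (e : OpenPartialHomeomorph M (Rn n)) (p : Evo n M)
    (T : ℝ × Rn n × Rn n →ₗ[ℝ] ℝ × Rn n × Rn n) :
    TangentSpace (IE n) p →ₗ[ℝ] TangentSpace (IE n) p :=
  (dcoords e p).inverse.toLinearMap ∘ₗ T ∘ₗ (dcoords e p).toLinearMap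

lemma dcoords_ofCoord (he : e ∈ IsManifold.maximalAtlas (𝓡 n) ∞ M) (hp : p ∈ adaptedDomain e)
    (T : ℝ × Rn n × Rn n →ₗ[ℝ] ℝ × Rn n × Rn n) (v : TangentSpace (IE n) p) :
    dcoords e p (ofCoord e p T v) = T (dcoords e p v) :=
  dcoords_inverse he hp _

section

variable (hΓ : IsSODE Γ)
include hΓ

lemma exists_isLieDerivAt (p : Evo n M) :
    ∃ L, IsLieDerivAt (IE n) Γ (vertEndo n M) p L := by
  have he := chartAt_mem_maximalAtlas p
  have hp := mem_adaptedDomain_chartAt p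
  refine ⟨ofCoord (chartAt (Rn n) p.2.proj) p (deformCoord Γ (chartAt (Rn n) p.2.proj) p),
    fun Y hY => ?_⟩
  refine dcoords_injective he hp ?_
  rw [dcoords_ofCoord he hp, deformCoord_dcoords hΓ he hp hY]

lemma isLieDerivAt_LS (p : Evo n M) :
    IsLieDerivAt (IE n) Γ (vertEndo n M) p (LS Γ p) :=
  Classical.epsilon_spec (exists_isLieDerivAt hΓ p)

/-- Any tangent vector extends to a field with constant components, which is smooth. Hence the
chosen `LS Γ p` is forced to have the coordinate expression in every adapted chart, not just in the
one used for existence. -/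
lemma dcoords_LS (he : e ∈ IsManifold.maximalAtlas (𝓡 n) ∞ M) (hp : p ∈ adaptedDomain e)
    (v : TangentSpace (IE n) p) :
    dcoords e p (LS Γ p v) = deformCoord Γ e p (dcoords e p v) := by
  have hs : SmoothAt (IE n) p (fieldOf (IE n) (coords e) fun _ => dcoords e p v) :=
    (isCoordSystem_coords he).smoothAt_fieldOf hp contMDiffAt_const
  have hv : fieldOf (IE n) (coords e) (fun _ => dcoords e p v) p = v :=
    dcoords_injective he hp (dcoords_fieldOf he hp _)
  have h := isLieDerivAt_LS hΓ p _ hs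
  have h' := deformCoord_dcoords hΓ he hp hs
  rw [← h, hv] at h'
  exact h'.symm

lemma LS_cubed (v : TangentSpace (IE n) p) : LS Γ p (LS Γ p (LS Γ p v)) = LS Γ p v := by
  have he := chartAt_mem_maximalAtlas p
  have hp := mem_adaptedDomain_chartAt p
  refine dcoords_injective he hp ?_
  simp only [dcoords_LS hΓ he hp, deformCoord_cubed]

variable (he : e ∈ IsManifold.maximalAtlas (𝓡 n) ∞ M) (hp : p ∈ adaptedDomain e)

lemma PΓ_add_PH_add_PV (v : TangentSpace (IE n) p) : PΓ Γ p v + PH Γ p v + PV Γ p v = v := by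
  simp only [PΓ, PH, PV, eigenProj_zero (LS_cubed hΓ), eigenProj_one (LS_cubed hΓ),
    eigenProj_neg_one (LS_cubed hΓ)]
  module

lemma PΓ_mem (v : TangentSpace (IE n) p) : PΓ Γ p v ∈ eigenDist Γ 0 p := by
  simp only [PΓ, eigenProj_zero (LS_cubed hΓ)]
  exact sub_sq_mem_eigenspace_zero (LS_cubed hΓ) v

lemma PH_mem (v : TangentSpace (IE n) p) : PH Γ p v ∈ eigenDist Γ (-1) p := by
  simp only [PH, eigenProj_neg_one (LS_cubed hΓ)]
  exact half_sq_sub_mem_eigenspace_neg_one (LS_cubed hΓ) v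

lemma PV_mem (v : TangentSpace (IE n) p) : PV Γ p v ∈ eigenDist Γ 1 p := by
  simp only [PV, eigenProj_one (LS_cubed hΓ)]
  exact half_sq_add_mem_eigenspace_one (LS_cubed hΓ) v

include he hp

/-- The vertical components `y² - y⁰ F - ½ A(θ)` of a tangent vector. -/
lemma dcoords_PV (v : TangentSpace (IE n) p) :
    dcoords e p (PV Γ p v) = (0, 0, (dcoords e p v).2.2 - (dcoords e p v).1 • forceVec Γ e p -
      (1 / 2 : ℝ) • forceDeriv Γ e p (contactCoord e p (dcoords e p v))) := by
  simp only [PV, eigenProj_one (LS_cubed hΓ), map_smul, map_add, dcoords_LS hΓ he hp,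
    deformCoord_deformCoord]
  rw [deformCoord_apply]
  refine Prod.ext (by simp) (Prod.ext (by simp) ?_)
  simp only [Prod.smul_snd, Prod.snd_add]
  module

lemma dcoords_PH (v : TangentSpace (IE n) p) :
    dcoords e p (PH Γ p v) = (0, contactCoord e p (dcoords e p v),
      (1 / 2 : ℝ) • forceDeriv Γ e p (contactCoord e p (dcoords e p v))) := by
  simp only [PH, eigenProj_neg_one (LS_cubed hΓ), map_smul, map_sub, dcoords_LS hΓ he hp,
    deformCoord_deformCoord]
  rw [deformCoord_apply]
  refine Prod.ext (by simp) (Prod.ext ?_ ?_)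
  · simp only [Prod.smul_snd, Prod.snd_sub, Prod.smul_fst, Prod.fst_sub]
    module
  · simp only [Prod.smul_snd, Prod.snd_sub]
    module

omit he hp in
-- In coordinates `y - L²y = y⁰(1, u, F)`.
lemma PΓ_apply (v : TangentSpace (IE n) p) : PΓ Γ p v = dt p v • Γ p := by
  have he := chartAt_mem_maximalAtlas p
  have hp := mem_adaptedDomain_chartAt p
  refine dcoords_injective he hp ?_
  simp only [PΓ, eigenProj_zero (LS_cubed hΓ), map_smul, map_sub, dcoords_LS hΓ he hp,
    deformCoord_deformCoord, hΓ.dcoords_eq he hp, ← dcoords_fst he hp]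
  refine Prod.ext (by simp) (Prod.ext ?_ ?_)
  · simp [contactCoord_apply]
  · simp

lemma mem_eigenDist_iff {μ : ℝ} (v : TangentSpace (IE n) p) :
    v ∈ eigenDist Γ μ p ↔ deformCoord Γ e p (dcoords e p v) = μ • dcoords e p v := by
  rw [eigenDist, Module.End.mem_eigenspace_iff, ← dcoords_LS hΓ he hp, ← map_smul]
  exact ⟨fun h => by rw [h], fun h => dcoords_injective he hp h⟩

lemma mem_eigenDist_one_iff (v : TangentSpace (IE n) p) :
    v ∈ eigenDist Γ 1 p ↔ (dcoords e p v).1 = 0 ∧ (dcoords e p v).2.1 = 0 := by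
  rw [mem_eigenDist_iff hΓ he hp, deformCoord_apply, one_smul, contactCoord_apply]
  constructor
  · intro h
    have h0 : (dcoords e p v).1 = 0 := (congrArg Prod.fst h).symm
    have h1 := congrArg (fun z => z.2.1) h
    simp only [h0, zero_smul, sub_zero] at h1
    -- The middle component of the eigenvalue equation reads `-y¹ = y¹`.
    have h2 : (2 : ℝ) • (dcoords e p v).2.1 = 0 := by
      rw [two_smul]
      nth_rewrite 1 [← h1]
      exact neg_add_cancel _
    exact ⟨h0, (smul_eq_zero.1 h2).resolve_left two_ne_zero⟩
  · rintro ⟨h0, h1⟩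
    refine Prod.ext h0.symm (Prod.ext ?_ ?_) <;> simp [h0, h1]

lemma mem_eigenDist_neg_one_iff (v : TangentSpace (IE n) p) :
    v ∈ eigenDist Γ (-1) p ↔ (dcoords e p v).1 = 0 ∧
      (dcoords e p v).2.2 = (1 / 2 : ℝ) • forceDeriv Γ e p (dcoords e p v).2.1 := by
  rw [mem_eigenDist_iff hΓ he hp, deformCoord_apply, contactCoord_apply]
  constructor
  · intro h
    have h0 : (dcoords e p v).1 = 0 := by
      have := congrArg Prod.fst h
      simp only [Prod.smul_fst, smul_eq_mul] at this
      linarith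
    have h2 := congrArg (fun z => z.2.2) h
    simp only [h0, zero_smul, sub_zero, Prod.smul_snd] at h2
    refine ⟨h0, ?_⟩
    rw [sub_eq_iff_eq_add] at h2
    -- The last component reads `y² - Ay¹ = -y²`. This is the origin of the factor `-½` in `Γⁱ_j`.
    have : (2 : ℝ) • (dcoords e p v).2.2 = forceDeriv Γ e p (dcoords e p v).2.1 := by
      rw [two_smul]
      nth_rewrite 1 [h2]
      module
    rw [← this]
    module
  · rintro ⟨h0, h1⟩
    refine Prod.ext (by simp [h0]) (Prod.ext (by simp [h0]) ?_)
    simp only [h0, zero_smul, sub_zero, Prod.smul_snd, h1]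
    module

omit he hp in
lemma eigenDist_zero_eq (p : Evo n M) : eigenDist Γ 0 p = Submodule.span ℝ {Γ p} := by
  have he := chartAt_mem_maximalAtlas p
  have hp := mem_adaptedDomain_chartAt p
  ext v
  rw [Submodule.mem_span_singleton]
  constructor
  · intro hv
    refine ⟨dt p v, ?_⟩
    rw [← PΓ_apply hΓ, PΓ, eigenProj_zero (LS_cubed hΓ)]
    rw [eigenDist, Module.End.mem_eigenspace_iff, zero_smul] at hv
    simp [hv]
  · rintro ⟨c, rfl⟩
    refine Submodule.smul_mem _ _ ?_
    rw [mem_eigenDist_iff hΓ he hp, hΓ.dcoords_eq he hp, deformCoord_apply]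
    simp [contactCoord_apply]

omit he hp in
lemma eigenDist_one_eq (p : Evo n M) : eigenDist Γ 1 p = vertSpace p := by
  have he := chartAt_mem_maximalAtlas p
  have hp := mem_adaptedDomain_chartAt p
  ext v
  rw [mem_eigenDist_one_iff hΓ he hp, mem_vertSpace_iff he hp]

end

section

lemma dcoords_partialX (he : e ∈ IsManifold.maximalAtlas (𝓡 n) ∞ M) (hp : p ∈ adaptedDomain e)
    (i : Fin n) : dcoords e p (partialX e i p) = (0, EuclideanSpace.single i 1, 0) :=
  dcoords_inverse he hp _

lemma dcoords_vertFrame (he : e ∈ IsManifold.maximalAtlas (𝓡 n) ∞ M) (hp : p ∈ adaptedDomain e)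
    (i : Fin n) : dcoords e p (vertFrame e i p) = (0, 0, EuclideanSpace.single i 1) :=
  dcoords_inverse he hp _

variable (hΓ : IsSODE Γ) (he : e ∈ IsManifold.maximalAtlas (𝓡 n) ∞ M) (hp : p ∈ adaptedDomain e)
include hΓ he hp

lemma nlc_eq (i j : Fin n) :
    nlc Γ e i j p = -(1 / 2 : ℝ) * forceDeriv Γ e p (EuclideanSpace.single j 1) i := by
  have h1 : dirDeriv (IE n) (vertFrame e j) (force Γ e i) p =
      vecDeriv (IE n) (vertFrame e j) (forceVec Γ e) p i :=
    vecDeriv_clm _ (EuclideanSpace.proj i : Rn n →L[ℝ] ℝ)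
      ((contMDiffAt_forceVec hΓ he hp).mdifferentiableAt (by simp))
  rw [nlc, h1, vecDeriv_forceVec he hp (dcoords_vertFrame he hp j)]

lemma sum_nlc_single (i : Fin n) :
    ∑ j, nlc Γ e j i p • (EuclideanSpace.single j 1 : Rn n) =
      -(1 / 2 : ℝ) • forceDeriv Γ e p (EuclideanSpace.single i 1) := by
  refine Eq.trans (Finset.sum_congr rfl fun j _ => ?_)
    (sum_smul_single (-(1 / 2 : ℝ) • forceDeriv Γ e p (EuclideanSpace.single i 1)))
  rw [nlc_eq hΓ he hp]
  rfl

lemma dcoords_horFrame (i : Fin n) : dcoords e p (horFrame Γ e i p) =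
    (0, EuclideanSpace.single i 1,
      (1 / 2 : ℝ) • forceDeriv Γ e p (EuclideanSpace.single i 1)) := by
  have h : dcoords e p (∑ j, nlc Γ e j i p • vertFrame e j p) =
      (0, 0, -(1 / 2 : ℝ) • forceDeriv Γ e p (EuclideanSpace.single i 1)) := by
    rw [map_sum, ← sum_nlc_single hΓ he hp i]
    simp only [map_smul, dcoords_vertFrame he hp]
    refine Prod.ext (by simp [Prod.fst_sum]) (Prod.ext ?_ ?_)
    · simp [Prod.fst_sum, Prod.snd_sum]
    · simp [Prod.snd_sum]
  rw [horFrame, map_sub, h, dcoords_partialX he hp]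
  refine Prod.ext (by simp) (Prod.ext (by simp) ?_)
  simp

lemma sum_horFrame (a : Rn n) : dcoords e p (∑ i, a i • horFrame Γ e i p) =
    (0, a, (1 / 2 : ℝ) • forceDeriv Γ e p a) := by
  have ha := (sum_smul_single a).symm
  rw [map_sum]
  simp only [map_smul, dcoords_horFrame hΓ he hp]
  refine Prod.ext (by simp [Prod.fst_sum]) (Prod.ext ?_ ?_)
  · conv_rhs => rw [ha]
    simp [Prod.fst_sum, Prod.snd_sum]
  · conv_rhs => rw [ha]
    simp [Prod.snd_sum, map_sum, Finset.smul_sum, smul_comm (2⁻¹ : ℝ)]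

omit hΓ in
lemma sum_vertFrame (a : Rn n) : dcoords e p (∑ i, a i • vertFrame e i p) = (0, 0, a) := by
  have ha := (sum_smul_single a).symm
  rw [map_sum]
  simp only [map_smul, dcoords_vertFrame he hp]
  refine Prod.ext (by simp [Prod.fst_sum]) (Prod.ext ?_ ?_)
  · simp [Prod.fst_sum, Prod.snd_sum]
  · conv_rhs => rw [ha]
    simp [Prod.snd_sum]

lemma horFrame_mem (i : Fin n) : horFrame Γ e i p ∈ eigenDist Γ (-1) p := by
  rw [mem_eigenDist_neg_one_iff hΓ he hp, dcoords_horFrame hΓ he hp]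
  exact ⟨rfl, rfl⟩

/-- A horizontal vector is determined by its middle component, whose entries are therefore its
coefficients on the `H_i`. -/
lemma eigenDist_neg_one_eq : eigenDist Γ (-1) p =
    Submodule.span ℝ (Set.range fun i : Fin n => horFrame Γ e i p) := by
  refine le_antisymm (fun v hv => ?_) (Submodule.span_le.2 ?_)
  · have h : v = ∑ i, (dcoords e p v).2.1 i • horFrame Γ e i p := by
      refine dcoords_injective he hp ?_
      rw [mem_eigenDist_neg_one_iff hΓ he hp] at hv
      rw [sum_horFrame hΓ he hp, ← hv.2]
      exact Prod.ext hv.1 rfl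
    rw [h]
    exact Submodule.sum_mem _ fun i _ =>
      Submodule.smul_mem _ _ (Submodule.subset_span ⟨i, rfl⟩)
  · rintro _ ⟨i, rfl⟩
    exact horFrame_mem hΓ he hp i

end

end Eigen

end SODEGeometry

end

/-! ### Operators of the form `T₁([P(X), T₂(Y)])` -/

noncomputable section

namespace SODEGeometry

section General

variable {A : Type*} [NormedAddCommGroup A] [NormedSpace ℝ A] {H : Type*} [TopologicalSpace H]
  {I : ModelWithCorners ℝ A H} {N : Type*} [TopologicalSpace N] [ChartedSpace H N]

/-- The operator `(X, Y) ↦ T₁([P(X), T₂(Y)])`. -/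
def bracketOp (T₁ P T₂ : EndField I N) (X Y : VField I N) : VField I N :=
  fun p => T₁ p (bracket I (P.on X) (T₂.on Y) p)

/-- The complement `id - T` of a field of endomorphisms. -/
def EndField.compl (T : EndField I N) : EndField I N := fun p => LinearMap.id - T p

variable [IsManifold I 1 N]

/-- `T` maps vector fields which are smooth near `p` to such vector fields, for all `p`. -/
def IsSmoothTensorAt (T : EndField I N) : Prop :=
  ∀ (p : N) (Y : VField I N), SmoothAt I p Y → SmoothAt I p (T.on Y)

lemma IsSmoothTensorAt.isSmoothTensor {T : EndField I N} (h : IsSmoothTensorAt T) :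
    IsSmoothTensor I T :=
  fun _ hU Y hY => smoothOn_of_smoothAt fun p hp => h p Y (hY.smoothAt hU hp)

lemma isSmoothTensorAt_id : IsSmoothTensorAt (fun _ => LinearMap.id : EndField I N) :=
  fun _ _ hY => hY

lemma IsSmoothTensorAt.compl {T : EndField I N} (h : IsSmoothTensorAt T) :
    IsSmoothTensorAt T.compl :=
  fun p Y hY => hY.sub (h p Y hY)

lemma IsSmoothTensorAt.comp {T T' : EndField I N} (h : IsSmoothTensorAt T)
    (h' : IsSmoothTensorAt T') : IsSmoothTensorAt (fun p => T p ∘ₗ T' p : EndField I N) :=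
  fun p Y hY => h p _ (h' p Y hY)

variable [IsManifold I ∞ N] [CompleteSpace A] {T₁ P T₂ : EndField I N} {X X' Y Y' : VField I N}
  {p : N}

lemma smoothAt_bracketOp (h₁ : IsSmoothTensorAt T₁) (hP : IsSmoothTensorAt P)
    (h₂ : IsSmoothTensorAt T₂) (hX : SmoothAt I p X) (hY : SmoothAt I p Y) :
    SmoothAt I p (bracketOp T₁ P T₂ X Y) :=
  h₁ p _ ((hP p X hX).bracket (h₂ p Y hY))

lemma bracketOp_add_left (hP : IsSmoothTensorAt P) (hX : SmoothAt I p X)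
    (hX' : SmoothAt I p X') : bracketOp T₁ P T₂ (fun q => X q + X' q) Y p =
      bracketOp T₁ P T₂ X Y p + bracketOp T₁ P T₂ X' Y p := by
  have h : P.on (fun q => X q + X' q) = fun q => P.on X q + P.on X' q :=
    funext fun q => map_add (P q) _ _
  rw [bracketOp, h, bracket_add_left (hP p X hX) (hP p X' hX'), map_add]
  rfl

lemma bracketOp_add_right (h₂ : IsSmoothTensorAt T₂) (hY : SmoothAt I p Y)
    (hY' : SmoothAt I p Y') : bracketOp T₁ P T₂ X (fun q => Y q + Y' q) p =
      bracketOp T₁ P T₂ X Y p + bracketOp T₁ P T₂ X Y' p := by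
  have h : T₂.on (fun q => Y q + Y' q) = fun q => T₂.on Y q + T₂.on Y' q :=
    funext fun q => map_add (T₂ q) _ _
  rw [bracketOp, h, bracket_add_right (h₂ p Y hY) (h₂ p Y' hY'), map_add]
  rfl

/-- The obstruction to function-linearity in `X` is the bracket term proportional to `P(X)`, and
`T₁` annihilates it. -/
lemma bracketOp_smul_left {f : N → ℝ} (hP : IsSmoothTensorAt P)
    (hf : ContMDiffAt I 𝓘(ℝ, ℝ) ∞ f p) (hX : SmoothAt I p X) (h0 : T₁ p (P p (X p)) = 0) :
    bracketOp T₁ P T₂ (fun q => f q • X q) Y p = f p • bracketOp T₁ P T₂ X Y p := by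
  have h : P.on (fun q => f q • X q) = fun q => f q • P.on X q :=
    funext fun q => map_smul (P q) _ _
  have h0' : T₁ p (P.on X p) = 0 := h0
  rw [bracketOp, h, bracket_smul_left hf (hP p X hX), map_add, map_smul, map_smul, h0', smul_zero,
    zero_add]
  rfl

/-- The function is differentiated along `P(X)` rather than `X`. A full Leibniz rule therefore needs
a second operator built on the complementary projector. -/
lemma bracketOp_leibniz {f : N → ℝ} (h₂ : IsSmoothTensorAt T₂)
    (hf : ContMDiffAt I 𝓘(ℝ, ℝ) ∞ f p) (hY : SmoothAt I p Y) :
    bracketOp T₁ P T₂ X (fun q => f q • Y q) p =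
      dirDeriv I (P.on X) f p • T₁ p (T₂ p (Y p)) + f p • bracketOp T₁ P T₂ X Y p := by
  have h : T₂.on (fun q => f q • Y q) = fun q => f q • T₂.on Y q :=
    funext fun q => map_smul (T₂ q) _ _
  rw [bracketOp, h, bracket_smul_right hf (h₂ p Y hY), map_add, map_smul, map_smul]
  rfl

/-- `(X, Y) ↦ T₁([X, T₂(Y)])` is a covariant derivative on any distribution which `T₁` annihilates
and on which `T₁ ∘ T₂` is the identity. -/
lemma isCovDerivOn_bracketOp {Δ : (p : N) → Submodule ℝ (TangentSpace I p)}
    (h₁ : IsSmoothTensorAt T₁) (h₂ : IsSmoothTensorAt T₂)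
    (h0 : ∀ p, ∀ v ∈ Δ p, T₁ p v = 0) (hid : ∀ p, ∀ v ∈ Δ p, T₁ p (T₂ p v) = v) :
    IsCovDerivOn I Δ (bracketOp T₁ (fun _ => LinearMap.id) T₂) where
  smooth U hU X Y hX hY _ _ := smoothOn_of_smoothAt fun p hp =>
    smoothAt_bracketOp h₁ isSmoothTensorAt_id h₂ (hX.smoothAt hU hp) (hY.smoothAt hU hp)
  add_left U hU X X' Y hX hX' _ _ _ _ p hp :=
    bracketOp_add_left isSmoothTensorAt_id (hX.smoothAt hU hp) (hX'.smoothAt hU hp)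
  add_right U hU X Y Y' _ hY hY' _ _ _ p hp :=
    bracketOp_add_right h₂ (hY.smoothAt hU hp) (hY'.smoothAt hU hp)
  smul_left U hU f X Y hf hX _ hXΔ _ p hp :=
    bracketOp_smul_left isSmoothTensorAt_id (hf.contMDiffAt (hU.mem_nhds hp)) (hX.smoothAt hU hp)
      (h0 p _ (hXΔ p hp))
  leibniz U hU f X Y hf _ hY _ hYΔ p hp := by
    rw [bracketOp_leibniz h₂ (hf.contMDiffAt (hU.mem_nhds hp)) (hY.smoothAt hU hp),
      hid p _ (hYΔ p hp)]
    rfl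

end General

variable {n : ℕ} {M : Type*} [TopologicalSpace M] [ChartedSpace (Rn n) M]
  [IsManifold (𝓡 n) ∞ M]

/-! ### The tensor `Q`, its algebra, and smoothness of the projectors -/

section QTensor

variable (Γ : VField (IE n) (Evo n M)) (e : OpenPartialHomeomorph M (Rn n)) (p : Evo n M)

/-- The vertical components of a tangent vector with respect to `Γ`, `H_i`, `V_i`. -/
def vertCoord : ℝ × Rn n × Rn n →ₗ[ℝ] Rn n where
  toFun y := y.2.2 - y.1 • forceVec Γ e p - (1 / 2 : ℝ) • forceDeriv Γ e p (contactCoord e p y)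
  map_add' y z := by simp; module
  map_smul' c y := by simp; module

/-- The coordinate expression of `Q`. -/
def qCoord : ℝ × Rn n × Rn n →ₗ[ℝ] ℝ × Rn n × Rn n where
  toFun y := (0, vertCoord Γ e p y, (1 / 2 : ℝ) • forceDeriv Γ e p (vertCoord Γ e p y))
  map_add' y z := by simp
  map_smul' c y := by simp [smul_comm c]

variable {Γ e p}

lemma vertCoord_apply (y : ℝ × Rn n × Rn n) : vertCoord Γ e p y =
    y.2.2 - y.1 • forceVec Γ e p - (1 / 2 : ℝ) • forceDeriv Γ e p (contactCoord e p y) := rfl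

lemma qCoord_apply (y : ℝ × Rn n × Rn n) : qCoord Γ e p y =
    (0, vertCoord Γ e p y, (1 / 2 : ℝ) • forceDeriv Γ e p (vertCoord Γ e p y)) := rfl

lemma dcoords_vertEndo' (he : e ∈ IsManifold.maximalAtlas (𝓡 n) ∞ M) (hp : p ∈ adaptedDomain e)
    (v : TangentSpace (IE n) p) :
    dcoords e p (vertEndo n M p v) = (0, 0, contactCoord e p (dcoords e p v)) :=
  dcoords_vertEndo he hp v

variable (hΓ : IsSODE Γ)
include hΓ

lemma exists_isQAt (p : Evo n M) : ∃ q, IsQAt Γ p q := by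
  have he := chartAt_mem_maximalAtlas p
  have hp := mem_adaptedDomain_chartAt p
  refine ⟨ofCoord (chartAt (Rn n) p.2.proj) p (qCoord Γ (chartAt (Rn n) p.2.proj) p),
    fun v => ?_, fun v => ?_, fun v => ?_⟩
  · rw [mem_eigenDist_neg_one_iff hΓ he hp, dcoords_ofCoord he hp]
    exact ⟨rfl, rfl⟩
  · refine dcoords_injective he hp ?_
    rw [dcoords_ofCoord he hp, dcoords_PH hΓ he hp, dcoords_vertEndo' he hp, qCoord_apply,
      vertCoord_apply]
    simp [contactCoord_apply]
  · refine dcoords_injective he hp ?_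
    rw [dcoords_vertEndo' he hp, dcoords_PV hΓ he hp, dcoords_ofCoord he hp, qCoord_apply]
    simp [contactCoord_apply, vertCoord_apply]

/-- A horizontal vector is determined by its middle component, and `S ∘ q = P_V` prescribes that
component. This gives uniqueness of `Q` and its formula in every adapted chart. -/
lemma dcoords_of_isQAt (he : e ∈ IsManifold.maximalAtlas (𝓡 n) ∞ M) (hp : p ∈ adaptedDomain e)
    {q : TangentSpace (IE n) p →ₗ[ℝ] TangentSpace (IE n) p} (hq : IsQAt Γ p q)
    (v : TangentSpace (IE n) p) : dcoords e p (q v) = qCoord Γ e p (dcoords e p v) := by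
  obtain ⟨h1, -, h3⟩ := hq
  obtain ⟨h0, h2⟩ := (mem_eigenDist_neg_one_iff hΓ he hp _).1 (h1 v)
  have h4 := congrArg (dcoords e p) (h3 v)
  rw [dcoords_vertEndo' he hp, dcoords_PV hΓ he hp] at h4
  have h5 : (dcoords e p (q v)).2.1 = vertCoord Γ e p (dcoords e p v) := by
    have := congrArg (fun z => z.2.2) h4
    simpa [contactCoord_apply, h0, vertCoord_apply] using this
  rw [qCoord_apply]
  exact Prod.ext h0 (Prod.ext h5 (by rw [h2, h5]))

lemma isQAt_Q (p : Evo n M) : IsQAt Γ p (Q Γ p) :=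
  Classical.epsilon_spec (exists_isQAt hΓ p)

lemma dcoords_Q (he : e ∈ IsManifold.maximalAtlas (𝓡 n) ∞ M) (hp : p ∈ adaptedDomain e)
    (v : TangentSpace (IE n) p) : dcoords e p (Q Γ p v) = qCoord Γ e p (dcoords e p v) :=
  dcoords_of_isQAt hΓ he hp (isQAt_Q hΓ p) v

lemma IsQAt.eq_Q {q : TangentSpace (IE n) p →ₗ[ℝ] TangentSpace (IE n) p} (hq : IsQAt Γ p q) :
    q = Q Γ p := by
  have he := chartAt_mem_maximalAtlas p
  have hp := mem_adaptedDomain_chartAt p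
  refine LinearMap.ext fun v => dcoords_injective he hp ?_
  rw [dcoords_of_isQAt hΓ he hp hq, dcoords_Q hΓ he hp]

lemma Q_vertEndo (v : TangentSpace (IE n) p) : Q Γ p (vertEndo n M p v) = PH Γ p v :=
  (isQAt_Q hΓ p).2.1 v

lemma vertEndo_Q (v : TangentSpace (IE n) p) : vertEndo n M p (Q Γ p v) = PV Γ p v :=
  (isQAt_Q hΓ p).2.2 v

lemma Q_PH (v : TangentSpace (IE n) p) : Q Γ p (PH Γ p v) = 0 := by
  have he := chartAt_mem_maximalAtlas p
  have hp := mem_adaptedDomain_chartAt p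
  refine dcoords_injective he hp ?_
  rw [dcoords_Q hΓ he hp, dcoords_PH hΓ he hp, qCoord_apply, vertCoord_apply]
  simp [contactCoord_apply]

omit hΓ in
lemma vertEndo_vertEndo (v : TangentSpace (IE n) p) :
    vertEndo n M p (vertEndo n M p v) = 0 := by
  have he := chartAt_mem_maximalAtlas p
  have hp := mem_adaptedDomain_chartAt p
  refine dcoords_injective he hp ?_
  rw [dcoords_vertEndo' he hp, dcoords_vertEndo' he hp]
  simp [contactCoord_apply]

lemma vertEndo_PV (v : TangentSpace (IE n) p) : vertEndo n M p (PV Γ p v) = 0 := by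
  rw [← vertEndo_Q hΓ, vertEndo_vertEndo]

lemma PH_of_mem {v : TangentSpace (IE n) p} (hv : v ∈ eigenDist Γ (-1) p) : PH Γ p v = v := by
  rw [eigenDist, Module.End.mem_eigenspace_iff] at hv
  simp only [PH, eigenProj_neg_one (LS_cubed hΓ), hv, map_smul]
  module

lemma PV_of_mem {v : TangentSpace (IE n) p} (hv : v ∈ eigenDist Γ 1 p) : PV Γ p v = v := by
  rw [eigenDist, Module.End.mem_eigenspace_iff] at hv
  simp only [PV, eigenProj_one (LS_cubed hΓ), hv, map_smul]
  module

lemma PV_of_mem_neg_one {v : TangentSpace (IE n) p} (hv : v ∈ eigenDist Γ (-1) p) :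
    PV Γ p v = 0 := by
  rw [eigenDist, Module.End.mem_eigenspace_iff] at hv
  simp only [PV, eigenProj_one (LS_cubed hΓ), hv, map_smul]
  module

lemma PH_of_mem_one {v : TangentSpace (IE n) p} (hv : v ∈ eigenDist Γ 1 p) : PH Γ p v = 0 := by
  rw [eigenDist, Module.End.mem_eigenspace_iff] at hv
  simp only [PH, eigenProj_neg_one (LS_cubed hΓ), hv, map_smul]
  module

lemma PH_self (p : Evo n M) : PH Γ p (Γ p) = 0 := by
  have h : Γ p ∈ eigenDist Γ 0 p := by
    rw [eigenDist_zero_eq hΓ]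
    exact Submodule.mem_span_singleton_self _
  rw [eigenDist, Module.End.mem_eigenspace_iff] at h
  simp [PH, eigenProj_neg_one (LS_cubed hΓ), h]

lemma PV_self (p : Evo n M) : PV Γ p (Γ p) = 0 := by
  have h : Γ p ∈ eigenDist Γ 0 p := by
    rw [eigenDist_zero_eq hΓ]
    exact Submodule.mem_span_singleton_self _
  rw [eigenDist, Module.End.mem_eigenspace_iff] at h
  simp [PV, eigenProj_one (LS_cubed hΓ), h]

lemma vertEndo_self (p : Evo n M) : vertEndo n M p (Γ p) = 0 := by
  have he := chartAt_mem_maximalAtlas p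
  have hp := mem_adaptedDomain_chartAt p
  refine dcoords_injective he hp ?_
  rw [dcoords_vertEndo' he hp, hΓ.dcoords_eq he hp]
  simp [contactCoord_apply]

lemma Q_self (p : Evo n M) : Q Γ p (Γ p) = 0 := by
  have he := chartAt_mem_maximalAtlas p
  have hp := mem_adaptedDomain_chartAt p
  refine dcoords_injective he hp ?_
  rw [dcoords_Q hΓ he hp, hΓ.dcoords_eq he hp, qCoord_apply, vertCoord_apply]
  simp [contactCoord_apply]

/-- `S` kills `Γ` and the vertical vectors, so it sees only the horizontal part. Together with
`Q_PV` this removes the inner projectors from the glued operator. -/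
lemma vertEndo_PH (v : TangentSpace (IE n) p) :
    vertEndo n M p (PH Γ p v) = vertEndo n M p v := by
  conv_rhs => rw [← PΓ_add_PH_add_PV hΓ v]
  rw [map_add, map_add, vertEndo_PV hΓ, PΓ_apply hΓ, map_smul, vertEndo_self hΓ]
  simp

lemma Q_PV (v : TangentSpace (IE n) p) : Q Γ p (PV Γ p v) = Q Γ p v := by
  conv_rhs => rw [← PΓ_add_PH_add_PV hΓ v]
  rw [map_add, map_add, Q_PH hΓ, PΓ_apply hΓ, map_smul, Q_self hΓ]
  simp

/-- The function in question is the derivative of `F` along the smooth vertical field with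
components `(0, 0, b)`, so smoothness of an operator-valued map need not be discussed. -/
lemma contMDiffAt_forceDeriv (he : e ∈ IsManifold.maximalAtlas (𝓡 n) ∞ M)
    (hp : p ∈ adaptedDomain e) {b : Evo n M → Rn n} (hb : ContMDiffAt (IE n) 𝓘(ℝ, Rn n) ∞ b p) :
    ContMDiffAt (IE n) 𝓘(ℝ, Rn n) ∞ (fun q => forceDeriv Γ e q (b q)) p := by
  have hg : ContMDiffAt (IE n) 𝓘(ℝ, ℝ × Rn n × Rn n) ∞
      (fun q => ((0, 0, b q) : ℝ × Rn n × Rn n)) p :=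
    (contMDiffAt_const (c := (0 : ℝ))).prodMk_space
      ((contMDiffAt_const (c := (0 : Rn n))).prodMk_space hb)
  have hs : SmoothAt (IE n) p (fieldOf (IE n) (coords e) fun q => (0, 0, b q)) :=
    (isCoordSystem_coords he).smoothAt_fieldOf hp hg
  exact hs.vecDeriv (contMDiffAt_forceVec hΓ he hp)

omit hΓ in
lemma isSmoothTensorAt_vertEndo : IsSmoothTensorAt (vertEndo n M) :=
  fun _ _ hY => smoothAt_vertEndo hY

omit hΓ in
lemma contMDiffAt_half_smul {b : Evo n M → Rn n} (hb : ContMDiffAt (IE n) 𝓘(ℝ, Rn n) ∞ b p) :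
    ContMDiffAt (IE n) 𝓘(ℝ, Rn n) ∞ (fun q => (1 / 2 : ℝ) • b q) p :=
  ((1 / 2 : ℝ) • ContinuousLinearMap.id ℝ (Rn n)).contMDiff.contMDiffAt.comp p hb

omit hΓ in
lemma contMDiffAt_contactCoord (he : e ∈ IsManifold.maximalAtlas (𝓡 n) ∞ M)
    (hp : p ∈ adaptedDomain e) {Y : VField (IE n) (Evo n M)} (hY : SmoothAt (IE n) p Y) :
    ContMDiffAt (IE n) 𝓘(ℝ, Rn n) ∞ (fun q => contactCoord e q (dcoords e q (Y q))) p := by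
  have hy := contMDiffAt_components he hp hY
  exact (contMDiffAt_snd_fst_component hy).sub ((contMDiffAt_fst_component hy).smul
    (contMDiffAt_velocity he hp))

lemma contMDiffAt_vertCoord (he : e ∈ IsManifold.maximalAtlas (𝓡 n) ∞ M)
    (hp : p ∈ adaptedDomain e) {Y : VField (IE n) (Evo n M)} (hY : SmoothAt (IE n) p Y) :
    ContMDiffAt (IE n) 𝓘(ℝ, Rn n) ∞ (fun q => vertCoord Γ e q (dcoords e q (Y q))) p := by
  have hy := contMDiffAt_components he hp hY
  exact ((contMDiffAt_snd_snd_component hy).sub ((contMDiffAt_fst_component hy).smul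
    (contMDiffAt_forceVec hΓ he hp))).sub
      (contMDiffAt_half_smul (contMDiffAt_forceDeriv hΓ he hp (contMDiffAt_contactCoord he hp hY)))

lemma isSmoothTensorAt_Q : IsSmoothTensorAt (Q Γ) := by
  intro p Y hY
  have he := chartAt_mem_maximalAtlas p
  have hp := mem_adaptedDomain_chartAt p
  set e := chartAt (Rn n) p.2.proj
  refine smoothAt_of_components he hp ?_
  have hr := contMDiffAt_vertCoord hΓ he hp hY
  have hq : ContMDiffAt (IE n) 𝓘(ℝ, ℝ × Rn n × Rn n) ∞
      (fun q => qCoord Γ e q (dcoords e q (Y q))) p :=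
    (contMDiffAt_const (c := (0 : ℝ))).prodMk_space (hr.prodMk_space
      (contMDiffAt_half_smul (contMDiffAt_forceDeriv hΓ he hp hr)))
  refine hq.congr_of_eventuallyEq ?_
  filter_upwards [eventually_mem_adaptedDomain hp] with q hq
  exact dcoords_Q hΓ he hq _

/-- The projector is defined point by point from an eigenspace, which says nothing about regularity;
the factorization `P_H = Q ∘ S` does. -/
lemma isSmoothTensorAt_PH : IsSmoothTensorAt (PH Γ) := by
  have h : PH Γ = fun p => Q Γ p ∘ₗ vertEndo n M p :=
    funext fun p => LinearMap.ext fun v => (Q_vertEndo hΓ v).symm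
  rw [h]
  exact (isSmoothTensorAt_Q hΓ).comp isSmoothTensorAt_vertEndo

lemma isSmoothTensorAt_PV : IsSmoothTensorAt (PV Γ) := by
  have h : PV Γ = fun p => vertEndo n M p ∘ₗ Q Γ p :=
    funext fun p => LinearMap.ext fun v => (vertEndo_Q hΓ v).symm
  rw [h]
  exact isSmoothTensorAt_vertEndo.comp (isSmoothTensorAt_Q hΓ)

omit hΓ in
lemma contMDiffAt_dt {Y : VField (IE n) (Evo n M)} (hY : SmoothAt (IE n) p Y) :
    ContMDiffAt (IE n) 𝓘(ℝ, ℝ) ∞ (fun q => dt q (Y q)) p := by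
  have h : ContMDiffAt (IE n) 𝓘(ℝ, ℝ) ∞ (fun q : Evo n M => q.1) p := contMDiffAt_fst
  exact hY.vecDeriv h

lemma isSmoothTensorAt_PΓ : IsSmoothTensorAt (PΓ Γ) := by
  intro p Y hY
  refine ((hΓ.smoothAt p).smul (contMDiffAt_dt hY)).congr ?_
  exact Filter.Eventually.of_forall fun q => (PΓ_apply hΓ (Y q)).symm

omit hΓ in
-- This is closedness of `dt`, read from the first component of the bracket.
lemma dt_bracket {X Y : VField (IE n) (Evo n M)} (hX : SmoothAt (IE n) p X)
    (hY : SmoothAt (IE n) p Y) :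
    dt p (bracket (IE n) X Y p) = dirDeriv (IE n) X (fun q => dt q (Y q)) p -
      dirDeriv (IE n) Y (fun q => dt q (X q)) p := by
  have he := chartAt_mem_maximalAtlas p
  have hp := mem_adaptedDomain_chartAt p
  have key : ∀ {X Y : VField (IE n) (Evo n M)}, SmoothAt (IE n) p Y →
      (vecDeriv (IE n) X (fun q => dcoords (chartAt (Rn n) p.2.proj) q (Y q)) p).1 =
        dirDeriv (IE n) X (fun q => dt q (Y q)) p := by
    intro X Y hY
    rw [vecDeriv_fst X ((contMDiffAt_components he hp hY).mdifferentiableAt (by simp))]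
    exact vecDeriv_congr rfl
      ((eventually_mem_adaptedDomain hp).mono fun q hq => dcoords_fst he hq _)
  rw [← dcoords_fst he hp, dcoords_bracket he hp hX hY, Prod.fst_sub, key hY, key hX]

end QTensor

end SODEGeometry

end

/-! ### The covariant derivatives on the three eigendistributions -/

noncomputable section

namespace SODEGeometry

variable {n : ℕ} {M : Type*} [TopologicalSpace M] [ChartedSpace (Rn n) M]
  [IsManifold (𝓡 n) ∞ M] {Γ : VField (IE n) (Evo n M)} (hΓ : IsSODE Γ)

section Distributions

variable {p : Evo n M} {X X' Y Y' : VField (IE n) (Evo n M)}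

include hΓ in
lemma smoothAt_covΓ (hX : SmoothAt (IE n) p X) (hY : SmoothAt (IE n) p Y) :
    SmoothAt (IE n) p (covΓ Γ X Y) :=
  SmoothAt.smul (hX.vecDeriv (contMDiffAt_dt hY)) (hΓ.smoothAt p)

lemma covΓ_add_left (X X' Y : VField (IE n) (Evo n M)) (p : Evo n M) :
    covΓ Γ (fun q => X q + X' q) Y p = covΓ Γ X Y p + covΓ Γ X' Y p := by
  simp only [covΓ, dirDeriv, map_add]
  exact add_smul _ _ _

lemma covΓ_smul_left (f : Evo n M → ℝ) (X Y : VField (IE n) (Evo n M)) (p : Evo n M) :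
    covΓ Γ (fun q => f q • X q) Y p = f p • covΓ Γ X Y p := by
  simp only [covΓ, dirDeriv, map_smul]
  exact mul_smul (f p) (dirDeriv (IE n) X (fun q => dt q (Y q)) p) (Γ p)

lemma covΓ_add_right (hY : SmoothAt (IE n) p Y) (hY' : SmoothAt (IE n) p Y') :
    covΓ Γ X (fun q => Y q + Y' q) p = covΓ Γ X Y p + covΓ Γ X Y' p := by
  have h := vecDeriv_add X ((contMDiffAt_dt hY).mdifferentiableAt (by simp))
    ((contMDiffAt_dt hY').mdifferentiableAt (by simp))
  simp only [covΓ, dirDeriv_eq_vecDeriv, map_add, h, add_smul]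

lemma covΓ_leibniz {f : Evo n M → ℝ} (hf : ContMDiffAt (IE n) 𝓘(ℝ, ℝ) ∞ f p)
    (hY : SmoothAt (IE n) p Y) : covΓ Γ X (fun q => f q • Y q) p =
      dirDeriv (IE n) X f p • dt p (Y p) • Γ p + f p • covΓ Γ X Y p := by
  have h := vecDeriv_smul X (hf.mdifferentiableAt (by simp))
    ((contMDiffAt_dt hY).mdifferentiableAt (by simp))
  simp only [covΓ, dirDeriv_eq_vecDeriv, map_smul, h, add_smul]
  simp only [smul_eq_mul, mul_smul]
  exact add_comm _ _

include hΓ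

lemma dt_smul_of_mem {v : TangentSpace (IE n) p} (hv : v ∈ eigenDist Γ 0 p) :
    dt p v • Γ p = v := by
  rw [eigenDist_zero_eq hΓ, Submodule.mem_span_singleton] at hv
  obtain ⟨c, rfl⟩ := hv
  rw [map_smul, hΓ.dt_eq, smul_eq_mul, mul_one]

lemma isCovDerivOn_covΓ : IsCovDerivOn (IE n) (eigenDist Γ 0) (covΓ Γ) where
  smooth U hU X Y hX hY _ _ := smoothOn_of_smoothAt fun p hp =>
    smoothAt_covΓ hΓ (hX.smoothAt hU hp) (hY.smoothAt hU hp)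
  add_left U hU X X' Y _ _ _ _ _ _ p _ := covΓ_add_left X X' Y p
  add_right U hU X Y Y' _ hY hY' _ _ _ p hp :=
    covΓ_add_right (hY.smoothAt hU hp) (hY'.smoothAt hU hp)
  smul_left U hU f X Y _ _ _ _ _ p _ := covΓ_smul_left f X Y p
  leibniz U hU f X Y hf _ hY _ hYΔ p hp := by
    rw [covΓ_leibniz (hf.contMDiffAt (hU.mem_nhds hp)) (hY.smoothAt hU hp),
      dt_smul_of_mem hΓ (hYΔ p hp)]

lemma preserves_covΓ : Preserves (IE n) (eigenDist Γ 0) (covΓ Γ) := by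
  intro U _ X Y _ _ _ _ p _
  rw [eigenDist_zero_eq hΓ]
  exact Submodule.smul_mem _ _ (Submodule.mem_span_singleton_self _)

/-- `Q` inverts `S` on horizontal vectors, which gives the Leibniz rule, and kills horizontal
vectors, which gives linearity in `X`. For `covV` the roles of `Q` and `S` are exchanged. -/
lemma isCovDerivOn_covH : IsCovDerivOn (IE n) (eigenDist Γ (-1)) (covH Γ) :=
  isCovDerivOn_bracketOp (isSmoothTensorAt_Q hΓ) isSmoothTensorAt_vertEndo
    (fun p v hv => by rw [← PH_of_mem hΓ hv, Q_PH hΓ])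
    (fun p v hv => by rw [Q_vertEndo hΓ, PH_of_mem hΓ hv])

lemma preserves_covH : Preserves (IE n) (eigenDist Γ (-1)) (covH Γ) :=
  fun _ _ _ _ _ _ _ _ p _ => (isQAt_Q hΓ p).1 _

lemma isCovDerivOn_covV : IsCovDerivOn (IE n) (eigenDist Γ 1) (covV Γ) :=
  isCovDerivOn_bracketOp isSmoothTensorAt_vertEndo (isSmoothTensorAt_Q hΓ)
    (fun p v hv => by rw [← PV_of_mem hΓ hv, vertEndo_PV hΓ])
    (fun p v hv => by rw [vertEndo_Q hΓ, PV_of_mem hΓ hv])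

lemma vertEndo_mem (v : TangentSpace (IE n) p) : vertEndo n M p v ∈ eigenDist Γ 1 p := by
  have he := chartAt_mem_maximalAtlas p
  have hp := mem_adaptedDomain_chartAt p
  rw [mem_eigenDist_one_iff hΓ he hp, dcoords_vertEndo he hp]
  exact ⟨rfl, rfl⟩

lemma preserves_covV : Preserves (IE n) (eigenDist Γ 1) (covV Γ) :=
  fun _ _ _ _ _ _ _ _ _ _ => vertEndo_mem hΓ _

end Distributions

/-! ### The glued operator is a linear connection -/

section Glued

/-- Here `x`, `h`, `v` stand for the derivatives of the function along `X`, `P_H(X)`, `P_V(X)`, and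
`a`, `b`, `c` for the `Γ`-, `H`- and `V`-parts of `Y`. -/
lemma leibniz_regroup {W : Type*} [AddCommGroup W] [Module ℝ W] (x h v f : ℝ)
    (a b c s₁ s₂ s₃ s₄ s₅ : W) :
    x • a + f • s₁ + (h • b + f • s₂) + (v • c + f • s₃) + ((x - h) • b + f • s₄) +
      ((x - v) • c + f • s₅) = x • (a + b + c) + f • (s₁ + s₂ + s₃ + s₄ + s₅) := by
  module

variable {p : Evo n M} {X X' Y Y' : VField (IE n) (Evo n M)}

/-- The five terms of the explicit formula for the glued operator. -/
def nablaSum (Γ X Y : VField (IE n) (Evo n M)) : VField (IE n) (Evo n M) := fun p =>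
  covΓ Γ X Y p + bracketOp (Q Γ) (PH Γ) (vertEndo n M) X Y p +
    bracketOp (vertEndo n M) (PV Γ) (Q Γ) X Y p +
    bracketOp (PH Γ) (PH Γ).compl (PH Γ) X Y p +
    bracketOp (PV Γ) (PV Γ).compl (PV Γ) X Y p

include hΓ

/-- Since `dt ∘ P_Γ = dt`, the form `dt` vanishes on `X - P_Γ(X)`. The bracket term thus has
`dt`-value `(X - P_Γ(X))(dt(Y))`, the part missing from `(P_Γ(X))(dt(Y))`. -/
lemma extendCov_covΓ (hX : SmoothAt (IE n) p X) (hY : SmoothAt (IE n) p Y) :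
    extendCov (PΓ Γ) (covΓ Γ) X ((PΓ Γ).on Y) p = covΓ Γ X Y p := by
  have hdt : ∀ (q : Evo n M) (v : TangentSpace (IE n) q), dt q (PΓ Γ q v) = dt q v := by
    intro q v
    rw [PΓ_apply hΓ, map_smul, hΓ.dt_eq, smul_eq_mul, mul_one]
  have hP := isSmoothTensorAt_PΓ hΓ p
  have h1 : (fun q => dt q ((PΓ Γ).on Y q)) = fun q => dt q (Y q) :=
    funext fun q => hdt q (Y q)
  have h2 : (fun q => dt q (X q - (PΓ Γ).on X q)) = fun _ => (0 : ℝ) :=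
    funext fun q => by rw [map_sub, sub_eq_zero]; exact (hdt q (X q)).symm
  have h3 : dirDeriv (IE n) X (fun q => dt q (Y q)) p =
      dirDeriv (IE n) ((PΓ Γ).on X) (fun q => dt q (Y q)) p +
      dirDeriv (IE n) (fun q => X q - (PΓ Γ).on X q) (fun q => dt q (Y q)) p :=
    vecDeriv_add_left (X := (PΓ Γ).on X) (Y := fun q => X q - (PΓ Γ).on X q) (Z := X)
      (add_sub_cancel _ _).symm _
  rw [extendCov, PΓ_apply hΓ, dt_bracket (hX.sub (hP X hX)) (hP Y hY), covΓ, covΓ, h1, h2, h3,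
    dirDeriv_eq_vecDeriv, dirDeriv_eq_vecDeriv, dirDeriv_eq_vecDeriv, vecDeriv_const, sub_zero,
    add_smul]

lemma nablaHat_eq_nablaSum (hX : SmoothAt (IE n) p X) (hY : SmoothAt (IE n) p Y) :
    nablaHat Γ X Y p = nablaSum Γ X Y p := by
  have hS : (vertEndo n M).on ((PH Γ).on Y) = (vertEndo n M).on Y :=
    funext fun q => vertEndo_PH hΓ (Y q)
  have hQ : (Q Γ).on ((PV Γ).on Y) = (Q Γ).on Y := funext fun q => Q_PV hΓ (Y q)
  have h : nablaHat Γ X Y p = extendCov (PΓ Γ) (covΓ Γ) X ((PΓ Γ).on Y) p +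
      extendCov (PH Γ) (covH Γ) X ((PH Γ).on Y) p +
      extendCov (PV Γ) (covV Γ) X ((PV Γ).on Y) p :=
    Fin.sum_univ_three (fun a : Fin 3 => extendCov (![PΓ Γ, PH Γ, PV Γ] a)
      (![covΓ Γ, covH Γ, covV Γ] a) X ((![PΓ Γ, PH Γ, PV Γ] a).on Y) p)
  rw [h, extendCov_covΓ hΓ hX hY, extendCov, extendCov, covH, covV, hS, hQ]
  have e : ∀ a b c d f : TangentSpace (IE n) p,
      a + (b + c) + (d + f) = a + b + d + c + f := fun a b c d f => by abel
  exact e _ _ _ _ _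

lemma smoothAt_nablaSum (hX : SmoothAt (IE n) p X) (hY : SmoothAt (IE n) p Y) :
    SmoothAt (IE n) p (nablaSum Γ X Y) :=
  ((((smoothAt_covΓ hΓ hX hY).add (smoothAt_bracketOp (isSmoothTensorAt_Q hΓ)
    (isSmoothTensorAt_PH hΓ) isSmoothTensorAt_vertEndo hX hY)).add
    (smoothAt_bracketOp isSmoothTensorAt_vertEndo (isSmoothTensorAt_PV hΓ)
    (isSmoothTensorAt_Q hΓ) hX hY)).add
    (smoothAt_bracketOp (isSmoothTensorAt_PH hΓ) (isSmoothTensorAt_PH hΓ).compl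
      (isSmoothTensorAt_PH hΓ) hX hY)).add
    (smoothAt_bracketOp (isSmoothTensorAt_PV hΓ) (isSmoothTensorAt_PV hΓ).compl
      (isSmoothTensorAt_PV hΓ) hX hY)

lemma nablaSum_add_left (hX : SmoothAt (IE n) p X) (hX' : SmoothAt (IE n) p X') :
    nablaSum Γ (fun q => X q + X' q) Y p = nablaSum Γ X Y p + nablaSum Γ X' Y p := by
  simp only [nablaSum]
  rw [covΓ_add_left, bracketOp_add_left (isSmoothTensorAt_PH hΓ) hX hX',
    bracketOp_add_left (isSmoothTensorAt_PV hΓ) hX hX',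
    bracketOp_add_left (isSmoothTensorAt_PH hΓ).compl hX hX',
    bracketOp_add_left (isSmoothTensorAt_PV hΓ).compl hX hX']
  abel

lemma nablaSum_add_right (hY : SmoothAt (IE n) p Y) (hY' : SmoothAt (IE n) p Y') :
    nablaSum Γ X (fun q => Y q + Y' q) p = nablaSum Γ X Y p + nablaSum Γ X Y' p := by
  simp only [nablaSum]
  rw [covΓ_add_right hY hY', bracketOp_add_right isSmoothTensorAt_vertEndo hY hY',
    bracketOp_add_right (isSmoothTensorAt_Q hΓ) hY hY',
    bracketOp_add_right (isSmoothTensorAt_PH hΓ) hY hY',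
    bracketOp_add_right (isSmoothTensorAt_PV hΓ) hY hY']
  abel

lemma PH_PH (v : TangentSpace (IE n) p) : PH Γ p (PH Γ p v) = PH Γ p v :=
  PH_of_mem hΓ (PH_mem hΓ v)

lemma PV_PV (v : TangentSpace (IE n) p) : PV Γ p (PV Γ p v) = PV Γ p v :=
  PV_of_mem hΓ (PV_mem hΓ v)

lemma nablaSum_smul_left {f : Evo n M → ℝ} (hf : ContMDiffAt (IE n) 𝓘(ℝ, ℝ) ∞ f p)
    (hX : SmoothAt (IE n) p X) :
    nablaSum Γ (fun q => f q • X q) Y p = f p • nablaSum Γ X Y p := by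
  simp only [nablaSum]
  rw [covΓ_smul_left, bracketOp_smul_left (isSmoothTensorAt_PH hΓ) hf hX (Q_PH hΓ _),
    bracketOp_smul_left (isSmoothTensorAt_PV hΓ) hf hX (vertEndo_PV hΓ _),
    bracketOp_smul_left (isSmoothTensorAt_PH hΓ).compl hf hX
      (by rw [EndField.compl, LinearMap.sub_apply, map_sub, PH_PH hΓ]; exact sub_self _),
    bracketOp_smul_left (isSmoothTensorAt_PV hΓ).compl hf hX
      (by rw [EndField.compl, LinearMap.sub_apply, map_sub, PV_PV hΓ]; exact sub_self _)]
  simp only [smul_add]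

lemma nablaSum_leibniz {f : Evo n M → ℝ} (hf : ContMDiffAt (IE n) 𝓘(ℝ, ℝ) ∞ f p)
    (hY : SmoothAt (IE n) p Y) : nablaSum Γ X (fun q => f q • Y q) p =
      dirDeriv (IE n) X f p • Y p + f p • nablaSum Γ X Y p := by
  have hd : ∀ T : EndField (IE n) (Evo n M), dirDeriv (IE n) (T.compl.on X) f p =
      dirDeriv (IE n) X f p - dirDeriv (IE n) (T.on X) f p :=
    fun T => dirDeriv_sub_left (X := X) (Y := T.on X) rfl f
  have h1 := covΓ_leibniz (Γ := Γ) (X := X) hf hY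
  have h2 := bracketOp_leibniz (T₁ := Q Γ) (P := PH Γ) (X := X)
    isSmoothTensorAt_vertEndo hf hY
  have h3 := bracketOp_leibniz (T₁ := vertEndo n M) (P := PV Γ) (X := X)
    (isSmoothTensorAt_Q hΓ) hf hY
  have h4 := bracketOp_leibniz (T₁ := PH Γ) (P := (PH Γ).compl) (X := X)
    (isSmoothTensorAt_PH hΓ) hf hY
  have h5 := bracketOp_leibniz (T₁ := PV Γ) (P := (PV Γ).compl) (X := X)
    (isSmoothTensorAt_PV hΓ) hf hY
  rw [← PΓ_apply hΓ] at h1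
  rw [Q_vertEndo hΓ] at h2
  rw [vertEndo_Q hΓ] at h3
  rw [PH_PH hΓ, hd] at h4
  rw [PV_PV hΓ, hd] at h5
  have h6 := PΓ_add_PH_add_PV hΓ (Y p)
  simp only [nablaSum]
  rw [h1, h2, h3, h4, h5, leibniz_regroup, h6]

lemma nablaSum_isLinearConnection : IsLinearConnection (IE n) (nablaSum Γ) where
  smooth _ hU _ _ hX hY _ _ := smoothOn_of_smoothAt fun _ hp =>
    smoothAt_nablaSum hΓ (hX.smoothAt hU hp) (hY.smoothAt hU hp)
  add_left _ hU _ _ _ hX hX' _ _ _ _ _ hp :=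
    nablaSum_add_left hΓ (hX.smoothAt hU hp) (hX'.smoothAt hU hp)
  add_right _ hU _ _ _ _ hY hY' _ _ _ _ hp :=
    nablaSum_add_right hΓ (hY.smoothAt hU hp) (hY'.smoothAt hU hp)
  smul_left _ hU _ _ _ hf hX _ _ _ _ hp :=
    nablaSum_smul_left hΓ (hf.contMDiffAt (hU.mem_nhds hp)) (hX.smoothAt hU hp)
  leibniz _ hU _ _ _ hf _ hY _ _ _ hp :=
    nablaSum_leibniz hΓ (hf.contMDiffAt (hU.mem_nhds hp)) (hY.smoothAt hU hp)

end Glued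

end SODEGeometry

end

/-! ### Locality of linear connections and determination by a frame -/

noncomputable section

namespace SODEGeometry

section General

variable {A : Type*} [NormedAddCommGroup A] [NormedSpace ℝ A] {H : Type*} [TopologicalSpace H]
  {I : ModelWithCorners ℝ A H} {N : Type*} [TopologicalSpace N] [ChartedSpace H N]
  [IsManifold I 1 N]

lemma SmoothOn.mono {U U' : Set N} {X : VField I N} (hX : SmoothOn I U X) (h : U' ⊆ U) :
    SmoothOn I U' X :=
  ContMDiffOn.mono hX h

lemma SmoothOn.congr {U : Set N} {X Y : VField I N} (hX : SmoothOn I U X)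
    (h : ∀ q ∈ U, Y q = X q) : SmoothOn I U Y :=
  ContMDiffOn.congr hX fun q hq => by rw [h q hq]

lemma SmoothOn.sub {U : Set N} {X Y : VField I N} (hX : SmoothOn I U X) (hY : SmoothOn I U Y) :
    SmoothOn I U (fun q => X q - Y q) :=
  ContMDiffOn.sub_section hX hY

lemma SmoothOn.smul {U : Set N} {f : N → ℝ} {X : VField I N} (hf : ContMDiffOn I 𝓘(ℝ, ℝ) ∞ f U)
    (hX : SmoothOn I U X) : SmoothOn I U (fun q => f q • X q) :=
  ContMDiffOn.smul_section hf hX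

lemma smoothOn_sum {ι : Type*} {s : Finset ι} {U : Set N} {X : ι → VField I N}
    (hX : ∀ i ∈ s, SmoothOn I U (X i)) : SmoothOn I U (fun q => ∑ i ∈ s, X i q) :=
  ContMDiffOn.sum_section hX

lemma smoothOn_zero (U : Set N) : SmoothOn I U (fun _ => 0 : VField I N) := by
  have h := smoothOn_sum (I := I) (s := (∅ : Finset ℕ)) (U := U) (X := fun _ _ => 0) (by simp)
  simpa using h

namespace IsLinearConnection

variable {D D' : VField I N → VField I N → VField I N} (hD : IsLinearConnection I D)
  {U : Set N} (hU : IsOpen U) {X X' Y Y' : VField I N} {p : N}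
include hD

/-- The axioms only ever evaluate the operator on smooth fields. `nablaHat` and `nablaSum` are
compared only there, so a pointwise transfer is needed. -/
lemma congr (h : ∀ p X Y, SmoothAt I p X → SmoothAt I p Y → D' X Y p = D X Y p) :
    IsLinearConnection I D' where
  smooth U hU X Y hX hY hX' hY' := (hD.smooth U hU X Y hX hY hX' hY').congr fun q hq =>
    h q X Y (hX.smoothAt hU hq) (hY.smoothAt hU hq)
  add_left U hU X X' Y hX hX' hY h1 h2 h3 p hp := by
    have hx := hX.smoothAt hU hp
    have hx' := hX'.smoothAt hU hp
    have hy := hY.smoothAt hU hp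
    rw [h p _ _ (hx.add hx') hy, h p X Y hx hy, h p X' Y hx' hy]
    exact hD.add_left U hU X X' Y hX hX' hY h1 h2 h3 p hp
  add_right U hU X Y Y' hX hY hY' h1 h2 h3 p hp := by
    have hx := hX.smoothAt hU hp
    have hy := hY.smoothAt hU hp
    have hy' := hY'.smoothAt hU hp
    rw [h p _ _ hx (hy.add hy'), h p X Y hx hy, h p X Y' hx hy']
    exact hD.add_right U hU X Y Y' hX hY hY' h1 h2 h3 p hp
  smul_left U hU f X Y hf hX hY h1 h2 p hp := by
    have hx := hX.smoothAt hU hp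
    have hy := hY.smoothAt hU hp
    rw [h p _ _ (SmoothAt.smul (hf.contMDiffAt (hU.mem_nhds hp)) hx) hy, h p X Y hx hy]
    exact hD.smul_left U hU f X Y hf hX hY h1 h2 p hp
  leibniz U hU f X Y hf hX hY h1 h2 p hp := by
    have hx := hX.smoothAt hU hp
    have hy := hY.smoothAt hU hp
    rw [h p _ _ hx (SmoothAt.smul (hf.contMDiffAt (hU.mem_nhds hp)) hy), h p X Y hx hy]
    exact hD.leibniz U hU f X Y hf hX hY h1 h2 p hp

include hU

lemma zero_left (hY : SmoothOn I U Y) (hX : ∀ q ∈ U, X q = 0) (hp : p ∈ U) : D X Y p = 0 := by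
  classical
  -- The function need be smooth only on `U`, where it is constantly `0`, and with the value `1`
  -- elsewhere `f • X = X` on the whole manifold. No bump function is needed.
  let f : N → ℝ := fun q => if q ∈ U then 0 else 1
  have hf : ContMDiffOn I 𝓘(ℝ, ℝ) ∞ f U :=
    (contMDiffOn_const (c := (0 : ℝ))).congr fun q hq => if_pos hq
  have h : (fun q => f q • X q) = X := by
    funext q
    by_cases hq : q ∈ U <;> simp [f, hq, hX]
  have h1 := hD.smul_left U hU f X Y hf ((smoothOn_zero U).congr hX) hY
    (fun _ _ => trivial) (fun _ _ => trivial) p hp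
  rw [h] at h1
  rw [h1, show f p = 0 from if_pos hp, zero_smul]

/-- Same device as for the left argument; the derivative term of the Leibniz rule is multiplied by
`Y p = 0`. -/
lemma zero_right (hX : SmoothOn I U X) (hY : ∀ q ∈ U, Y q = 0) (hp : p ∈ U) : D X Y p = 0 := by
  classical
  let f : N → ℝ := fun q => if q ∈ U then 0 else 1
  have hf : ContMDiffOn I 𝓘(ℝ, ℝ) ∞ f U :=
    (contMDiffOn_const (c := (0 : ℝ))).congr fun q hq => if_pos hq
  have h : (fun q => f q • Y q) = Y := by
    funext q
    by_cases hq : q ∈ U <;> simp [f, hq, hY]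
  have h1 := hD.leibniz U hU f X Y hf hX ((smoothOn_zero U).congr hY)
    (fun _ _ => trivial) (fun _ _ => trivial) p hp
  rw [h] at h1
  rw [h1, hY p hp, show f p = 0 from if_pos hp, zero_smul, smul_zero, add_zero]

lemma congr_left (hX : SmoothOn I U X) (hY : SmoothOn I U Y) (h : ∀ q ∈ U, X' q = X q)
    (hp : p ∈ U) : D X' Y p = D X Y p := by
  have hX' := hX.congr h
  have h1 := hD.add_left U hU X (fun q => X' q - X q) Y hX (hX'.sub hX) hY
    (fun _ _ => trivial) (fun _ _ => trivial) (fun _ _ => trivial) p hp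
  rw [hD.zero_left hU hY (fun q hq => sub_eq_zero.2 (h q hq)) hp, add_zero] at h1
  rw [← h1]
  congr 2
  funext q
  exact (add_sub_cancel _ _).symm

lemma congr_right (hX : SmoothOn I U X) (hY : SmoothOn I U Y) (h : ∀ q ∈ U, Y' q = Y q)
    (hp : p ∈ U) : D X Y' p = D X Y p := by
  have hY' := hY.congr h
  have h1 := hD.add_right U hU X Y (fun q => Y' q - Y q) hX hY (hY'.sub hY)
    (fun _ _ => trivial) (fun _ _ => trivial) (fun _ _ => trivial) p hp
  rw [hD.zero_right hU hX (fun q hq => sub_eq_zero.2 (h q hq)) hp, add_zero] at h1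
  rw [← h1]
  congr 2
  funext q
  exact (add_sub_cancel _ _).symm

variable {ι : Type*} {s : ι → VField I N} {f : ι → N → ℝ}

lemma sum_left (hs : ∀ i, SmoothOn I U (s i)) (hf : ∀ i, ContMDiffOn I 𝓘(ℝ, ℝ) ∞ (f i) U)
    (hY : SmoothOn I U Y) (hp : p ∈ U) (t : Finset ι) :
    D (fun q => ∑ i ∈ t, f i q • s i q) Y p = ∑ i ∈ t, f i p • D (s i) Y p := by
  classical
  induction t using Finset.induction_on with
  | empty => simpa using hD.zero_left hU (X := fun _ => 0) hY (fun _ _ => rfl) hp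
  | insert a t ha ih =>
    simp only [Finset.sum_insert ha]
    rw [← ih, ← hD.smul_left U hU (f a) (s a) Y (hf a) (hs a) hY
      (fun _ _ => trivial) (fun _ _ => trivial) p hp]
    exact hD.add_left U hU (fun q => f a q • s a q) (fun q => ∑ i ∈ t, f i q • s i q) Y
      (SmoothOn.smul (hf a) (hs a)) (smoothOn_sum fun i _ => SmoothOn.smul (hf i) (hs i)) hY
      (fun _ _ => trivial) (fun _ _ => trivial) (fun _ _ => trivial) p hp

lemma sum_right (hs : ∀ i, SmoothOn I U (s i)) (hf : ∀ i, ContMDiffOn I 𝓘(ℝ, ℝ) ∞ (f i) U)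
    (hX : SmoothOn I U X) (hp : p ∈ U) (t : Finset ι) :
    D X (fun q => ∑ i ∈ t, f i q • s i q) p =
      ∑ i ∈ t, (dirDeriv I X (f i) p • s i p + f i p • D X (s i) p) := by
  classical
  induction t using Finset.induction_on with
  | empty => simpa using hD.zero_right hU (Y := fun _ => 0) hX (fun _ _ => rfl) hp
  | insert a t ha ih =>
    simp only [Finset.sum_insert ha]
    rw [← ih, ← hD.leibniz U hU (f a) X (s a) (hf a) hX (hs a)
      (fun _ _ => trivial) (fun _ _ => trivial) p hp]
    exact hD.add_right U hU X (fun q => f a q • s a q) (fun q => ∑ i ∈ t, f i q • s i q)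
      hX (SmoothOn.smul (hf a) (hs a)) (smoothOn_sum fun i _ => SmoothOn.smul (hf i) (hs i))
      (fun _ _ => trivial) (fun _ _ => trivial) (fun _ _ => trivial) p hp

/-- Two linear connections with the same components in a local frame agree. -/
lemma eq_of_frame [Fintype ι] {g : ι → N → ℝ} (hD' : IsLinearConnection I D')
    (hs : ∀ i, SmoothOn I U (s i)) (h : ∀ i j, D (s i) (s j) p = D' (s i) (s j) p)
    (hf : ∀ i, ContMDiffOn I 𝓘(ℝ, ℝ) ∞ (f i) U) (hg : ∀ i, ContMDiffOn I 𝓘(ℝ, ℝ) ∞ (g i) U)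
    (hX : ∀ q ∈ U, X q = ∑ i, f i q • s i q) (hY : ∀ q ∈ U, Y q = ∑ i, g i q • s i q)
    (hp : p ∈ U) : D X Y p = D' X Y p := by
  have hfs : SmoothOn I U (fun q => ∑ i, f i q • s i q) :=
    smoothOn_sum fun i _ => SmoothOn.smul (hf i) (hs i)
  have hgs : SmoothOn I U (fun q => ∑ i, g i q • s i q) :=
    smoothOn_sum fun i _ => SmoothOn.smul (hg i) (hs i)
  -- The expansion involves the connection only through the values `D (s i) (s j) p`.
  have key : ∀ {D : VField I N → VField I N → VField I N}, IsLinearConnection I D →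
      D X Y p = ∑ i, f i p • ∑ j, (dirDeriv I (s i) (g j) p • s j p + g j p • D (s i) (s j) p) := by
    intro D hD
    rw [hD.congr_left hU hfs (hgs.congr hY) hX hp, hD.sum_left hU hs hf (hgs.congr hY) hp]
    refine Finset.sum_congr rfl fun i _ => ?_
    rw [hD.congr_right hU (hs i) hgs hY hp, hD.sum_right hU hs hg (hs i) hp]
  rw [key hD, key hD']
  simp only [h]

end IsLinearConnection

end General

end SODEGeometry

end

/-! ### Brackets of the adapted frame fields -/

noncomputable section

namespace SODEGeometry

variable {n : ℕ} {M : Type*} [TopologicalSpace M] [ChartedSpace (Rn n) M]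
  [IsManifold (𝓡 n) ∞ M] {Γ : VField (IE n) (Evo n M)}
  {e : OpenPartialHomeomorph M (Rn n)} {p : Evo n M}

section Frame

/-- The vector `(Γᵏ_i)_k` of components of the nonlinear connection. -/
def nlcVec (Γ : VField (IE n) (Evo n M)) (e : OpenPartialHomeomorph M (Rn n)) (i : Fin n)
    (p : Evo n M) : Rn n :=
  -((1 / 2 : ℝ) • forceDeriv Γ e p (EuclideanSpace.single i 1))

lemma smoothAt_vertFrame (he : e ∈ IsManifold.maximalAtlas (𝓡 n) ∞ M) (hp : p ∈ adaptedDomain e)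
    (i : Fin n) : SmoothAt (IE n) p (vertFrame e i) :=
  (isCoordSystem_coords he).smoothAt_fieldOf hp contMDiffAt_const

lemma vecDeriv_dcoords_vertFrame (he : e ∈ IsManifold.maximalAtlas (𝓡 n) ∞ M)
    (hp : p ∈ adaptedDomain e) (X : VField (IE n) (Evo n M)) (i : Fin n) :
    vecDeriv (IE n) X (fun q => dcoords e q (vertFrame e i q)) p = 0 := by
  rw [vecDeriv_congr (Y := X) (g := fun _ => ((0, 0, EuclideanSpace.single i 1) : ℝ × Rn n × Rn n))
    rfl, vecDeriv_const]
  filter_upwards [eventually_mem_adaptedDomain hp] with q hq using dcoords_vertFrame he hq i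

lemma vertFrame_mem (hΓ : IsSODE Γ) (he : e ∈ IsManifold.maximalAtlas (𝓡 n) ∞ M)
    (hp : p ∈ adaptedDomain e) (i : Fin n) : vertFrame e i p ∈ eigenDist Γ 1 p := by
  rw [mem_eigenDist_one_iff hΓ he hp, dcoords_vertFrame he hp]
  exact ⟨rfl, rfl⟩

variable (hΓ : IsSODE Γ) (he : e ∈ IsManifold.maximalAtlas (𝓡 n) ∞ M) (hp : p ∈ adaptedDomain e)
include hΓ he hp

lemma nlcVec_apply (i k : Fin n) : nlcVec Γ e i p k = nlc Γ e k i p := by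
  rw [nlc_eq hΓ he hp]
  simp [nlcVec]

lemma dcoords_horFrame_eq_nlcVec (i : Fin n) : dcoords e p (horFrame Γ e i p) =
    (0, EuclideanSpace.single i 1, -nlcVec Γ e i p) := by
  rw [dcoords_horFrame hΓ he hp, nlcVec, neg_neg]

lemma contMDiffAt_nlcVec (i : Fin n) : ContMDiffAt (IE n) 𝓘(ℝ, Rn n) ∞ (nlcVec Γ e i) p :=
  (contMDiffAt_half_smul (contMDiffAt_forceDeriv hΓ he hp contMDiffAt_const)).neg

lemma contMDiffAt_components_horFrame (i : Fin n) :
    ContMDiffAt (IE n) 𝓘(ℝ, ℝ × Rn n × Rn n) ∞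
      (fun q => ((0, EuclideanSpace.single i 1, -nlcVec Γ e i q) : ℝ × Rn n × Rn n)) p :=
  (contMDiffAt_const (c := (0 : ℝ))).prodMk_space
    ((contMDiffAt_const (c := (EuclideanSpace.single i 1 : Rn n))).prodMk_space
      (contMDiffAt_nlcVec hΓ he hp i).neg)

lemma eventually_dcoords_horFrame (i : Fin n) :
    (fun q => dcoords e q (horFrame Γ e i q)) =ᶠ[𝓝 p]
      fun q => ((0, EuclideanSpace.single i 1, -nlcVec Γ e i q) : ℝ × Rn n × Rn n) := by
  filter_upwards [eventually_mem_adaptedDomain hp] with q hq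
  exact dcoords_horFrame_eq_nlcVec hΓ he hq i

lemma smoothAt_horFrame (i : Fin n) : SmoothAt (IE n) p (horFrame Γ e i) :=
  smoothAt_of_components he hp ((contMDiffAt_components_horFrame hΓ he hp i).congr_of_eventuallyEq
    (eventually_dcoords_horFrame hΓ he hp i))

lemma vecDeriv_dcoords_horFrame (X : VField (IE n) (Evo n M)) (i : Fin n) :
    vecDeriv (IE n) X (fun q => dcoords e q (horFrame Γ e i q)) p =
      (0, 0, -vecDeriv (IE n) X (nlcVec Γ e i) p) := by
  have hm := (contMDiffAt_components_horFrame hΓ he hp i).mdifferentiableAt (by simp)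
  rw [vecDeriv_congr (Y := X) rfl (eventually_dcoords_horFrame hΓ he hp i)]
  refine Prod.ext ?_ (Prod.ext ?_ ?_)
  · rw [vecDeriv_fst X hm]
    exact vecDeriv_const X _ p
  · rw [vecDeriv_snd_fst X hm]
    exact vecDeriv_const X _ p
  · rw [vecDeriv_snd_snd X hm]
    exact vecDeriv_clm X (-ContinuousLinearMap.id ℝ (Rn n))
      ((contMDiffAt_nlcVec hΓ he hp i).mdifferentiableAt (by simp))

lemma vecDeriv_nlcVec_apply (X : VField (IE n) (Evo n M)) (i k : Fin n) :
    vecDeriv (IE n) X (nlcVec Γ e i) p k = dirDeriv (IE n) X (nlc Γ e k i) p := by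
  have h := vecDeriv_clm X (EuclideanSpace.proj k : Rn n →L[ℝ] ℝ)
    ((contMDiffAt_nlcVec hΓ he hp i).mdifferentiableAt (by simp))
  refine h.symm.trans (vecDeriv_congr rfl ?_)
  filter_upwards [eventually_mem_adaptedDomain hp] with q hq using nlcVec_apply hΓ he hq i k

lemma vertEndo_horFrame (i : Fin n) : vertEndo n M p (horFrame Γ e i p) = vertFrame e i p := by
  refine dcoords_injective he hp ?_
  rw [dcoords_vertEndo' he hp, dcoords_horFrame hΓ he hp, dcoords_vertFrame he hp]
  simp [contactCoord_apply]

lemma Q_vertFrame (i : Fin n) : Q Γ p (vertFrame e i p) = horFrame Γ e i p := by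
  rw [← vertEndo_horFrame hΓ he hp, Q_vertEndo hΓ, PH_of_mem hΓ (horFrame_mem hΓ he hp i)]

/-- `P_H` depends only on the contact form, so the last component of the bracket, which contains
derivatives of the `Γᵏ_i`, is not needed. -/
lemma dcoords_bracket_sode_horFrame (i : Fin n) :
    (dcoords e p (bracket (IE n) Γ (horFrame Γ e i) p)).1 = 0 ∧
    (dcoords e p (bracket (IE n) Γ (horFrame Γ e i) p)).2.1 = nlcVec Γ e i p := by
  rw [dcoords_bracket he hp (hΓ.smoothAt p) (smoothAt_horFrame hΓ he hp i),
    vecDeriv_dcoords_horFrame hΓ he hp, vecDeriv_dcoords_sode hΓ he hp,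
    dcoords_horFrame_eq_nlcVec hΓ he hp]
  simp

lemma PH_bracket_sode_horFrame (i : Fin n) : PH Γ p (bracket (IE n) Γ (horFrame Γ e i) p) =
    ∑ k, nlc Γ e k i p • horFrame Γ e k p := by
  refine dcoords_injective he hp ?_
  obtain ⟨h0, h1⟩ := dcoords_bracket_sode_horFrame hΓ he hp i
  simp only [← nlcVec_apply hΓ he hp]
  rw [sum_horFrame hΓ he hp, dcoords_PH hΓ he hp, contactCoord_apply, h0, h1, zero_smul, sub_zero]

/-- The bracket is `(0, -eᵢ, -A eᵢ)`, whose vertical part is `-A eᵢ + ½A eᵢ = -½A eᵢ`. -/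
lemma PV_bracket_sode_vertFrame (i : Fin n) : PV Γ p (bracket (IE n) Γ (vertFrame e i) p) =
    ∑ k, nlc Γ e k i p • vertFrame e k p := by
  have hb : dcoords e p (bracket (IE n) Γ (vertFrame e i) p) =
      (0, -EuclideanSpace.single i 1, -forceDeriv Γ e p (EuclideanSpace.single i 1)) := by
    rw [dcoords_bracket he hp (hΓ.smoothAt p) (smoothAt_vertFrame he hp i),
      vecDeriv_dcoords_vertFrame he hp, vecDeriv_dcoords_sode hΓ he hp,
      vecDeriv_forceVec he hp (dcoords_vertFrame he hp i), dcoords_vertFrame he hp]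
    simp
  refine dcoords_injective he hp ?_
  simp only [← nlcVec_apply hΓ he hp]
  rw [sum_vertFrame he hp, dcoords_PV hΓ he hp, contactCoord_apply, hb, nlcVec]
  refine Prod.ext rfl (Prod.ext rfl ?_)
  simp only [zero_smul, sub_zero, map_neg]
  module

/-- `V_j` has constant components, and only the vertical component of `H_i` varies. This single
bracket yields the coefficients of both `∇_{H_i} H_j` and `∇_{H_i} V_j`. -/
lemma dcoords_bracket_horFrame_vertFrame (i j : Fin n) :
    dcoords e p (bracket (IE n) (horFrame Γ e i) (vertFrame e j) p) =
      (0, 0, vecDeriv (IE n) (vertFrame e j) (nlcVec Γ e i) p) := by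
  rw [dcoords_bracket he hp (smoothAt_horFrame hΓ he hp i) (smoothAt_vertFrame he hp j),
    vecDeriv_dcoords_vertFrame he hp, vecDeriv_dcoords_horFrame hΓ he hp]
  simp

lemma Q_bracket_horFrame_vertFrame (i j : Fin n) :
    Q Γ p (bracket (IE n) (horFrame Γ e i) (vertFrame e j) p) =
      ∑ k, dnlc Γ e k i j p • horFrame Γ e k p := by
  refine dcoords_injective he hp ?_
  simp only [dnlc, ← vecDeriv_nlcVec_apply hΓ he hp]
  rw [sum_horFrame hΓ he hp, dcoords_Q hΓ he hp, dcoords_bracket_horFrame_vertFrame hΓ he hp,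
    qCoord_apply, vertCoord_apply, contactCoord_apply]
  simp

lemma PV_bracket_horFrame_vertFrame (i j : Fin n) :
    PV Γ p (bracket (IE n) (horFrame Γ e i) (vertFrame e j) p) =
      ∑ k, dnlc Γ e k i j p • vertFrame e k p := by
  refine dcoords_injective he hp ?_
  simp only [dnlc, ← vecDeriv_nlcVec_apply hΓ he hp]
  rw [sum_vertFrame he hp, dcoords_PV hΓ he hp, dcoords_bracket_horFrame_vertFrame hΓ he hp,
    contactCoord_apply]
  simp

/-- Verticality is what makes all derivatives along `V_i` of frame fields `H_j` and `V_j` vanish: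
`P_H` and `S` kill vertical vectors. -/
lemma bracket_vertFrame_horFrame_mem (i j : Fin n) :
    bracket (IE n) (vertFrame e i) (horFrame Γ e j) p ∈ eigenDist Γ 1 p := by
  rw [mem_eigenDist_one_iff hΓ he hp, dcoords_bracket he hp (smoothAt_vertFrame he hp i)
    (smoothAt_horFrame hΓ he hp j), vecDeriv_dcoords_vertFrame he hp,
    vecDeriv_dcoords_horFrame hΓ he hp]
  simp

omit he hp in
lemma vertEndo_of_mem {v : TangentSpace (IE n) p} (hv : v ∈ eigenDist Γ 1 p) :
    vertEndo n M p v = 0 := by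
  rw [← PV_of_mem hΓ hv, vertEndo_PV hΓ]

/-- The expansion of a tangent vector in an adapted frame. -/
lemma eq_sum_frame (v : TangentSpace (IE n) p) :
    v = dt p v • Γ p + (∑ i, contactCoord e p (dcoords e p v) i • horFrame Γ e i p +
      ∑ i, vertCoord Γ e p (dcoords e p v) i • vertFrame e i p) := by
  refine dcoords_injective he hp ?_
  rw [map_add, map_add, map_smul, sum_horFrame hΓ he hp, sum_vertFrame he hp,
    hΓ.dcoords_eq he hp, ← dcoords_fst he hp, vertCoord_apply, contactCoord_apply]
  refine Prod.ext ?_ (Prod.ext ?_ ?_)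
  · simp
  · simp
  · simp only [Prod.smul_mk, Prod.mk_add_mk]
    abel

end Frame

/-! ### The glued operator on the summands of the splitting -/

section Components

variable {X Y : VField (IE n) (Evo n M)} (hΓ : IsSODE Γ)
include hΓ

lemma nablaSum_sode (X : VField (IE n) (Evo n M)) (p : Evo n M) : nablaSum Γ X Γ p = 0 := by
  have h : covΓ Γ X Γ p = 0 := by
    simp only [covΓ, hΓ.dt_eq, dirDeriv_eq_vecDeriv, vecDeriv_const, zero_smul]
  simp only [nablaSum, bracketOp]
  rw [h, bracket_zero_right (Y := (vertEndo n M).on Γ) (.of_forall fun q => vertEndo_self hΓ q),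
    bracket_zero_right (Y := (Q Γ).on Γ) (.of_forall fun q => Q_self hΓ q),
    bracket_zero_right (Y := (PH Γ).on Γ) (.of_forall fun q => PH_self hΓ q),
    bracket_zero_right (Y := (PV Γ).on Γ) (.of_forall fun q => PV_self hΓ q)]
  simp

lemma dt_of_mem_one {v : TangentSpace (IE n) p} (hv : v ∈ eigenDist Γ 1 p) : dt p v = 0 := by
  have he := chartAt_mem_maximalAtlas p
  have hp := mem_adaptedDomain_chartAt p
  rw [← dcoords_fst he hp]
  exact ((mem_eigenDist_one_iff hΓ he hp v).1 hv).1

lemma dt_of_mem_neg_one {v : TangentSpace (IE n) p} (hv : v ∈ eigenDist Γ (-1) p) :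
    dt p v = 0 := by
  have he := chartAt_mem_maximalAtlas p
  have hp := mem_adaptedDomain_chartAt p
  rw [← dcoords_fst he hp]
  exact ((mem_eigenDist_neg_one_iff hΓ he hp v).1 hv).1

omit hΓ in
lemma covΓ_of_dt_eq_zero (h : ∀ᶠ q in 𝓝 p, dt q (Y q) = 0) : covΓ Γ X Y p = 0 := by
  have h1 := vecDeriv_congr (I := IE n) (X := X) (Y := X) (p := p) rfl
    (f := fun q => dt q (Y q)) (g := fun _ => 0) h
  rw [covΓ, dirDeriv_eq_vecDeriv, h1, vecDeriv_const, zero_smul]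

/-- On horizontal `Y` the quantities `dt(Y)`, `Q(Y)` and `P_V(Y)` vanish. They must vanish near `p`,
not only at `p`, for the derivative and the brackets to drop out. -/
lemma nablaSum_of_horizontal (hY : ∀ᶠ q in 𝓝 p, Y q ∈ eigenDist Γ (-1) q) :
    nablaSum Γ X Y p = Q Γ p (bracket (IE n) ((PH Γ).on X) ((vertEndo n M).on Y) p) +
      PH Γ p (bracket (IE n) ((PH Γ).compl.on X) Y p) := by
  have h1 : (PH Γ).on Y =ᶠ[𝓝 p] Y := hY.mono fun q hq => PH_of_mem hΓ hq
  have h2 : ∀ᶠ q in 𝓝 p, (Q Γ).on Y q = 0 := hY.mono fun q hq => by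
    rw [EndField.on, ← PH_of_mem hΓ hq, Q_PH hΓ]
  have h3 : ∀ᶠ q in 𝓝 p, (PV Γ).on Y q = 0 := hY.mono fun q hq => PV_of_mem_neg_one hΓ hq
  simp only [nablaSum, bracketOp]
  rw [covΓ_of_dt_eq_zero (hY.mono fun q hq => dt_of_mem_neg_one hΓ hq),
    bracket_zero_right h2, bracket_zero_right h3,
    bracket_congr (Filter.EventuallyEq.refl _ ((PH Γ).compl.on X)) h1]
  simp

lemma nablaSum_of_vertical (hY : ∀ᶠ q in 𝓝 p, Y q ∈ eigenDist Γ 1 q) :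
    nablaSum Γ X Y p = vertEndo n M p (bracket (IE n) ((PV Γ).on X) ((Q Γ).on Y) p) +
      PV Γ p (bracket (IE n) ((PV Γ).compl.on X) Y p) := by
  have h1 : (PV Γ).on Y =ᶠ[𝓝 p] Y := hY.mono fun q hq => PV_of_mem hΓ hq
  have h2 : ∀ᶠ q in 𝓝 p, (vertEndo n M).on Y q = 0 := hY.mono fun q hq => by
    rw [EndField.on, ← PV_of_mem hΓ hq, vertEndo_PV hΓ]
  have h3 : ∀ᶠ q in 𝓝 p, (PH Γ).on Y q = 0 := hY.mono fun q hq => PH_of_mem_one hΓ hq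
  simp only [nablaSum, bracketOp]
  rw [covΓ_of_dt_eq_zero (hY.mono fun q hq => dt_of_mem_one hΓ hq),
    bracket_zero_right h2, bracket_zero_right h3,
    bracket_congr (Filter.EventuallyEq.refl _ ((PV Γ).compl.on X)) h1]
  simp

end Components

end SODEGeometry

end

/-! ### The Massa–Pagani components and uniqueness -/

noncomputable section

namespace SODEGeometry

variable {n : ℕ} {M : Type*} [TopologicalSpace M] [ChartedSpace (Rn n) M]
  [IsManifold (𝓡 n) ∞ M] {Γ : VField (IE n) (Evo n M)}
  {e : OpenPartialHomeomorph M (Rn n)} {p : Evo n M} (hΓ : IsSODE Γ)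
include hΓ

lemma PH_compl_on_sode : (PH Γ).compl.on Γ = Γ :=
  funext fun q => (congrArg (fun v => Γ q - v) (PH_self hΓ q)).trans (sub_zero _)

lemma PV_compl_on_sode : (PV Γ).compl.on Γ = Γ :=
  funext fun q => (congrArg (fun v => Γ q - v) (PV_self hΓ q)).trans (sub_zero _)

section

variable (he : e ∈ IsManifold.maximalAtlas (𝓡 n) ∞ M) (hp : p ∈ adaptedDomain e)
include he hp

lemma eventually_horFrame_mem (i : Fin n) :
    ∀ᶠ q in 𝓝 p, horFrame Γ e i q ∈ eigenDist Γ (-1) q :=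
  (eventually_mem_adaptedDomain hp).mono fun _ hq => horFrame_mem hΓ he hq i

lemma eventually_vertFrame_mem (i : Fin n) : ∀ᶠ q in 𝓝 p, vertFrame e i q ∈ eigenDist Γ 1 q :=
  (eventually_mem_adaptedDomain hp).mono fun _ hq => vertFrame_mem hΓ he hq i

lemma vertEndo_on_horFrame (i : Fin n) :
    (vertEndo n M).on (horFrame Γ e i) =ᶠ[𝓝 p] vertFrame e i :=
  (eventually_mem_adaptedDomain hp).mono fun _ hq => vertEndo_horFrame hΓ he hq i

lemma Q_on_vertFrame (i : Fin n) : (Q Γ).on (vertFrame e i) =ᶠ[𝓝 p] horFrame Γ e i :=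
  (eventually_mem_adaptedDomain hp).mono fun _ hq => Q_vertFrame hΓ he hq i

/-- In this and the following component lemmas each frame field lies in one summand of the
splitting, so exactly one of the two surviving bracket terms is nonzero a priori. -/
lemma nablaSum_sode_horFrame (i : Fin n) : nablaSum Γ Γ (horFrame Γ e i) p =
    ∑ k, nlc Γ e k i p • horFrame Γ e k p := by
  rw [nablaSum_of_horizontal hΓ (eventually_horFrame_mem hΓ he hp i), PH_compl_on_sode hΓ,
    bracket_zero_left (X := (PH Γ).on Γ) (.of_forall fun q => PH_self hΓ q), map_zero, zero_add,
    PH_bracket_sode_horFrame hΓ he hp]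

lemma nablaSum_sode_vertFrame (i : Fin n) : nablaSum Γ Γ (vertFrame e i) p =
    ∑ k, nlc Γ e k i p • vertFrame e k p := by
  rw [nablaSum_of_vertical hΓ (eventually_vertFrame_mem hΓ he hp i), PV_compl_on_sode hΓ,
    bracket_zero_left (X := (PV Γ).on Γ) (.of_forall fun q => PV_self hΓ q), map_zero, zero_add,
    PV_bracket_sode_vertFrame hΓ he hp]

lemma nablaSum_horFrame_horFrame (i j : Fin n) :
    nablaSum Γ (horFrame Γ e i) (horFrame Γ e j) p =
      ∑ k, dnlc Γ e k i j p • horFrame Γ e k p := by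
  have hi := eventually_horFrame_mem hΓ he hp i
  have h1 : (PH Γ).on (horFrame Γ e i) =ᶠ[𝓝 p] horFrame Γ e i :=
    hi.mono fun q hq => PH_of_mem hΓ hq
  have h2 : ∀ᶠ q in 𝓝 p, (PH Γ).compl.on (horFrame Γ e i) q = 0 :=
    hi.mono fun q hq => sub_eq_zero.2 (PH_of_mem hΓ hq).symm
  rw [nablaSum_of_horizontal hΓ (eventually_horFrame_mem hΓ he hp j), bracket_zero_left h2,
    bracket_congr h1 (vertEndo_on_horFrame hΓ he hp j), map_zero, add_zero,
    Q_bracket_horFrame_vertFrame hΓ he hp]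

lemma nablaSum_horFrame_vertFrame (i j : Fin n) :
    nablaSum Γ (horFrame Γ e i) (vertFrame e j) p =
      ∑ k, dnlc Γ e k i j p • vertFrame e k p := by
  have hi := eventually_horFrame_mem hΓ he hp i
  have h1 : ∀ᶠ q in 𝓝 p, (PV Γ).on (horFrame Γ e i) q = 0 :=
    hi.mono fun q hq => PV_of_mem_neg_one hΓ hq
  have h2 : (PV Γ).compl.on (horFrame Γ e i) =ᶠ[𝓝 p] horFrame Γ e i :=
    h1.mono fun q hq => (congrArg (fun v => horFrame Γ e i q - v) hq).trans (sub_zero _)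
  rw [nablaSum_of_vertical hΓ (eventually_vertFrame_mem hΓ he hp j), bracket_zero_left h1,
    bracket_congr h2 (Filter.EventuallyEq.refl _ (vertFrame e j)), map_zero, zero_add,
    PV_bracket_horFrame_vertFrame hΓ he hp]

lemma nablaSum_vertFrame_horFrame (i j : Fin n) :
    nablaSum Γ (vertFrame e i) (horFrame Γ e j) p = 0 := by
  have hi := eventually_vertFrame_mem hΓ he hp i
  have h1 : ∀ᶠ q in 𝓝 p, (PH Γ).on (vertFrame e i) q = 0 :=
    hi.mono fun q hq => PH_of_mem_one hΓ hq
  have h2 : (PH Γ).compl.on (vertFrame e i) =ᶠ[𝓝 p] vertFrame e i :=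
    h1.mono fun q hq => (congrArg (fun v => vertFrame e i q - v) hq).trans (sub_zero _)
  rw [nablaSum_of_horizontal hΓ (eventually_horFrame_mem hΓ he hp j), bracket_zero_left h1,
    bracket_congr h2 (Filter.EventuallyEq.refl _ (horFrame Γ e j)), map_zero, zero_add,
    PH_of_mem_one hΓ (bracket_vertFrame_horFrame_mem hΓ he hp i j)]

lemma nablaSum_vertFrame_vertFrame (i j : Fin n) :
    nablaSum Γ (vertFrame e i) (vertFrame e j) p = 0 := by
  have hi := eventually_vertFrame_mem hΓ he hp i
  have h1 : (PV Γ).on (vertFrame e i) =ᶠ[𝓝 p] vertFrame e i :=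
    hi.mono fun q hq => PV_of_mem hΓ hq
  have h2 : ∀ᶠ q in 𝓝 p, (PV Γ).compl.on (vertFrame e i) q = 0 :=
    hi.mono fun q hq => sub_eq_zero.2 (PV_of_mem hΓ hq).symm
  rw [nablaSum_of_vertical hΓ (eventually_vertFrame_mem hΓ he hp j), bracket_zero_left h2,
    bracket_congr h1 (Q_on_vertFrame hΓ he hp j), map_zero, add_zero,
    vertEndo_of_mem hΓ (bracket_vertFrame_horFrame_mem hΓ he hp i j)]

end

lemma isMassaPagani_nablaHat : IsMassaPagani Γ (nablaHat Γ) where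
  linear := (nablaSum_isLinearConnection hΓ).congr fun _ _ _ => nablaHat_eq_nablaSum hΓ
  components e he p hp := by
    have hG := hΓ.smoothAt p
    have hH := smoothAt_horFrame hΓ he hp
    have hV := smoothAt_vertFrame he hp
    refine ⟨?_, fun i j => ⟨?_, ?_, ?_, ?_, ?_, ?_, ?_, ?_⟩⟩
    · rw [nablaHat_eq_nablaSum hΓ hG hG, nablaSum_sode hΓ]
    · rw [nablaHat_eq_nablaSum hΓ (hH i) hG, nablaSum_sode hΓ]
    · rw [nablaHat_eq_nablaSum hΓ (hV i) hG, nablaSum_sode hΓ]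
    · rw [nablaHat_eq_nablaSum hΓ hG (hH i), nablaSum_sode_horFrame hΓ he hp]
    · rw [nablaHat_eq_nablaSum hΓ hG (hV i), nablaSum_sode_vertFrame hΓ he hp]
    · rw [nablaHat_eq_nablaSum hΓ (hH i) (hH j), nablaSum_horFrame_horFrame hΓ he hp]
    · rw [nablaHat_eq_nablaSum hΓ (hH i) (hV j), nablaSum_horFrame_vertFrame hΓ he hp]
    · rw [nablaHat_eq_nablaSum hΓ (hV i) (hH j), nablaSum_vertFrame_horFrame hΓ he hp]
    · rw [nablaHat_eq_nablaSum hΓ (hV i) (hV j), nablaSum_vertFrame_vertFrame hΓ he hp]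

omit hΓ in
/-- The adapted frame `{Γ, H_i, V_i}`. -/
def adaptedFrame (Γ : VField (IE n) (Evo n M)) (e : OpenPartialHomeomorph M (Rn n)) :
    Unit ⊕ (Fin n ⊕ Fin n) → VField (IE n) (Evo n M) :=
  Sum.elim (fun _ => Γ) (Sum.elim (horFrame Γ e) (vertFrame e))

omit hΓ in
/-- The components of a vector field in the adapted frame. -/
def adaptedComponent (Γ : VField (IE n) (Evo n M)) (e : OpenPartialHomeomorph M (Rn n))
    (X : VField (IE n) (Evo n M)) : Unit ⊕ (Fin n ⊕ Fin n) → Evo n M → ℝ :=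
  Sum.elim (fun _ q => dt q (X q)) (Sum.elim
    (fun i q => contactCoord e q (dcoords e q (X q)) i)
    (fun i q => vertCoord Γ e q (dcoords e q (X q)) i))

section

variable (he : e ∈ IsManifold.maximalAtlas (𝓡 n) ∞ M)
include he

lemma smoothOn_adaptedFrame {U : Set (Evo n M)} (hU : U ⊆ adaptedDomain e)
    (a : Unit ⊕ (Fin n ⊕ Fin n)) : SmoothOn (IE n) U (adaptedFrame Γ e a) := by
  refine smoothOn_of_smoothAt fun p hp => ?_
  rcases a with _ | i | i
  · exact hΓ.smoothAt p
  · exact smoothAt_horFrame hΓ he (hU hp) i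
  · exact smoothAt_vertFrame he (hU hp) i

lemma contMDiffOn_adaptedComponent {U : Set (Evo n M)} (hU : IsOpen U) (hUe : U ⊆ adaptedDomain e)
    {X : VField (IE n) (Evo n M)} (hX : SmoothOn (IE n) U X) (a : Unit ⊕ (Fin n ⊕ Fin n)) :
    ContMDiffOn (IE n) 𝓘(ℝ, ℝ) ∞ (adaptedComponent Γ e X a) U := by
  intro p hp
  have hx := hX.smoothAt hU hp
  refine ContMDiffAt.contMDiffWithinAt ?_
  rcases a with _ | i | i
  · exact contMDiffAt_dt hx
  · exact (EuclideanSpace.proj i : Rn n →L[ℝ] ℝ).contMDiff.contMDiffAt.comp p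
      (contMDiffAt_contactCoord he (hUe hp) hx)
  · exact (EuclideanSpace.proj i : Rn n →L[ℝ] ℝ).contMDiff.contMDiffAt.comp p
      (contMDiffAt_vertCoord hΓ he (hUe hp) hx)

lemma eq_sum_adaptedFrame (X : VField (IE n) (Evo n M)) (hp : p ∈ adaptedDomain e) :
    X p = ∑ a, adaptedComponent Γ e X a p • adaptedFrame Γ e a p := by
  simp only [Fintype.sum_sum_type, Fintype.sum_unique]
  exact eq_sum_frame hΓ he hp (X p)

end

/-- Adapted frames exist only over chart domains, so near each point both connections are compared
on the intersection of `U` with such a domain. -/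
lemma IsMassaPagani.ext {D D' : VField (IE n) (Evo n M) → VField (IE n) (Evo n M) →
      VField (IE n) (Evo n M)} (hD : IsMassaPagani Γ D) (hD' : IsMassaPagani Γ D')
    {U : Set (Evo n M)} (hU : IsOpen U) {X Y : VField (IE n) (Evo n M)}
    (hX : SmoothOn (IE n) U X) (hY : SmoothOn (IE n) U Y) (hp : p ∈ U) :
    D X Y p = D' X Y p := by
  have he := chartAt_mem_maximalAtlas p
  have hpe := mem_adaptedDomain_chartAt p
  set e := chartAt (Rn n) p.2.proj
  have hU' : IsOpen (U ∩ adaptedDomain e) := hU.inter (isOpen_adaptedDomain e)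
  have hX' := hX.mono (Set.inter_subset_left (t := adaptedDomain e))
  have hY' := hY.mono (Set.inter_subset_left (t := adaptedDomain e))
  obtain ⟨h0, h⟩ := hD.components e he p hpe
  obtain ⟨h0', h'⟩ := hD'.components e he p hpe
  refine hD.linear.eq_of_frame hU' hD'.linear
    (smoothOn_adaptedFrame hΓ he Set.inter_subset_right) ?_
    (contMDiffOn_adaptedComponent hΓ he hU' Set.inter_subset_right hX')
    (contMDiffOn_adaptedComponent hΓ he hU' Set.inter_subset_right hY')
    (fun q hq => eq_sum_adaptedFrame hΓ he X hq.2) (fun q hq => eq_sum_adaptedFrame hΓ he Y hq.2)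
    ⟨hp, hpe⟩
  -- Components carrying a single index are stated under a pair of indices; they are read off on the
  -- diagonal.
  rintro (_ | i | i) (_ | j | j)
  · exact h0.trans h0'.symm
  · exact (h j j).2.2.1.trans (h' j j).2.2.1.symm
  · exact (h j j).2.2.2.1.trans (h' j j).2.2.2.1.symm
  · exact (h i i).1.trans (h' i i).1.symm
  · exact (h i j).2.2.2.2.1.trans (h' i j).2.2.2.2.1.symm
  · exact (h i j).2.2.2.2.2.1.trans (h' i j).2.2.2.2.2.1.symm
  · exact (h i i).2.1.trans (h' i i).2.1.symm
  · exact (h i j).2.2.2.2.2.2.1.trans (h' i j).2.2.2.2.2.2.1.symm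
  · exact (h i j).2.2.2.2.2.2.2.trans (h' i j).2.2.2.2.2.2.2.symm

end SODEGeometry

end

theorem theorem3p2 (n : ℕ) (M : Type*) [TopologicalSpace M]
    [ChartedSpace (Rn n) M] [IsManifold (𝓡 n) ∞ M]
    (Γ : VField (IE n) (Evo n M))
    (hΓ : IsSODE Γ) :
    -- the eigendistributions of the tensor field `𝓛_Γ S`, and the projectors
    (∀ p, IsLieDerivAt (IE n) Γ (vertEndo n M) p
        (LS Γ p)) ∧
    (∀ p, DirectSum.IsInternal
      (fun k : Fin 3 => eigenDist Γ ((![0, 1, -1] : Fin 3 → ℝ) k) p)) ∧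
    (∀ p, eigenDist Γ 0 p = Submodule.span ℝ {Γ p}) ∧
    (∀ p, eigenDist Γ 1 p = vertSpace p) ∧
    (∀ e ∈ IsManifold.maximalAtlas (𝓡 n) ∞ M, ∀ p ∈ adaptedDomain e,
      eigenDist Γ (-1) p =
        Submodule.span ℝ (Set.range fun i : Fin n => horFrame Γ e i p)) ∧
    (∀ p v, PΓ Γ p v ∈ eigenDist Γ 0 p ∧
      PH Γ p v ∈ eigenDist Γ (-1) p ∧
      PV Γ p v ∈ eigenDist Γ 1 p ∧
      PΓ Γ p v + PH Γ p v + PV Γ p v = v) ∧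
    -- the tensor field `Q`
    (∀ p, IsQAt Γ p (Q Γ p) ∧
      ∀ q, IsQAt Γ p q → q = Q Γ p) ∧
    IsSmoothTensor (IE n) (Q Γ) ∧
    -- the covariant derivatives on the eigendistributions
    (IsCovDerivOn (IE n) (eigenDist Γ 0)
        (covΓ Γ) ∧
      Preserves (IE n) (eigenDist Γ 0)
        (covΓ Γ)) ∧
    (IsCovDerivOn (IE n) (eigenDist Γ (-1))
        (covH Γ) ∧
      Preserves (IE n) (eigenDist Γ (-1))
        (covH Γ)) ∧
    (IsCovDerivOn (IE n) (eigenDist Γ 1)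
        (covV Γ) ∧
      Preserves (IE n) (eigenDist Γ 1)
        (covV Γ)) ∧
    -- the glued operator is the Massa–Pagani connection
    IsMassaPagani Γ (nablaHat Γ) ∧
    (∀ D, IsMassaPagani Γ D → ∀ U : Set (Evo n M), IsOpen U →
      ∀ X Y, SmoothOn (IE n) U X →
        SmoothOn (IE n) U Y →
        ∀ p ∈ U, D X Y p = nablaHat Γ X Y p) ∧
    -- the explicit formula
    (∀ U : Set (Evo n M), IsOpen U →
      ∀ X Y, SmoothOn (IE n) U X →
        SmoothOn (IE n) U Y → ∀ p ∈ U,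
        nablaHat Γ X Y p =
          dirDeriv (IE n) X
            (fun q => dt q (Y q)) p • Γ p
          + Q Γ p (bracket (IE n)
              ((PH Γ).on X) ((vertEndo n M).on Y) p)
          + vertEndo n M p (bracket (IE n)
              ((PV Γ).on X) ((Q Γ).on Y) p)
          + PH Γ p (bracket (IE n)
              (fun q => X q - (PH Γ).on X q) ((PH Γ).on Y) p)
          + PV Γ p (bracket (IE n)
              (fun q => X q - (PV Γ).on X q) ((PV Γ).on Y) p)) := by
  refine ⟨isLieDerivAt_LS hΓ, fun p => isInternal_eigenspace (LS_cubed hΓ),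
    eigenDist_zero_eq hΓ, eigenDist_one_eq hΓ,
    fun e he p hp => eigenDist_neg_one_eq hΓ he hp,
    fun p v => ⟨PΓ_mem hΓ v, PH_mem hΓ v, PV_mem hΓ v, PΓ_add_PH_add_PV hΓ v⟩,
    fun p => ⟨isQAt_Q hΓ p, fun q hq => hq.eq_Q hΓ⟩,
    (isSmoothTensorAt_Q hΓ).isSmoothTensor,
    ⟨isCovDerivOn_covΓ hΓ, preserves_covΓ hΓ⟩,
    ⟨isCovDerivOn_covH hΓ, preserves_covH hΓ⟩,
    ⟨isCovDerivOn_covV hΓ, preserves_covV hΓ⟩,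
    isMassaPagani_nablaHat hΓ,
    fun D hD U hU X Y hX hY p hp => hD.ext hΓ (isMassaPagani_nablaHat hΓ) hU hX hY hp,
    -- The explicit formula is `nablaSum` with `covΓ`, `bracketOp` and `compl` unfolded, so it holds
    -- definitionally from here.
    fun U hU X Y hX hY p hp =>
      nablaHat_eq_nablaSum hΓ (hX.smoothAt hU hp) (hY.smoothAt hU hp)⟩
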